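/- Let $l\ge 2$, and let $p_1,\dots,p_l$ be probability mass functions on $\mathbb N^l$ ($\mathbb N$ includes $0$). For $y\in\mathbb N^l$ write $|y|=\sum_k y_k$, and let $Y^{(i)}$ denote a random vector with law $p_i$. Let $(Z_n)_{n\ge0}$ be the $l$-type Galton–Watson process started from one individual of an arbitrary fixed type $j_0$: $Z_0=e_{j_0}$ and $$Z_n=\sum_{j=1}^l\sum_{i=1}^{Z_{n-1,j}}Y^{(j)}_{n-1,i}\qquad(n\ge1),$$ where the offspring vectors $Y^{(j)}_{m,i}$ are independent and $Y^{(j)}_{m,i}$ has law $p_j$. Let $M=(m_{ik})$ be the matrix with $m_{ik}=\mathbb E\big(Y^{(i)}_k\big)$. Let $(r_n)$ be a sequence of positive integers. Assume: 1. for every $j$: $p_j(\mathbf 0)=0$ and $\sum_{k=1}^l p_j(e_k)<1$; 2. some power of $M$ has only positive entries, and the largest eigenvalue $\rho$ of $M$ satisfies $\rho>1$; 3. $r_n^2\rho^{-n}\to0$, and there are real constants $C,K$ with $\mathbb E(|Y^{(i)}|^2)\le C$ and $\mathbb E(|Y^{(i)}|^{-1})\le K$ for $i=1,\dots,l$. For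 each $n\ge1$ a sample of $r_n$ individuals is drawn from generation $n$ uniformly at random without replacement. Let $D_n$ be the event that this sample exists (that is, $|Z_n|\ge r_n$) and that no two of the $r_n$ sampled individuals have the same parent. Then $$\mathbb P(D_n)\to1\quad\text{as }n\to\infty,$$ and for every $\alpha\in(0,-\log_\rho K)$, $$\rho^{\alpha n}\,r_n^{-2}\,\bigl(1-\mathbb P(D_n)\bigr)\to0\quad\text{as }n\to\infty.$$ -/

import Mathlib

open MeasureTheory ProbabilityTheory Filter Topology
open scoped ENNReal

namespace GaltonWatson

/-- The `L¹` norm `|y| = y₁ + ⋯ + y_l` of a vector of nonnegative integers. -/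
def size {l : ℕ} (y : Fin l → ℕ) : ℕ := ∑ k, y k

/-- The `l × l` reproduction matrix: `M i k` is the mean number of type-`k` children of an
individual of type `i`. -/
noncomputable def reproductionMatrix {l : ℕ} (p : Fin l → PMF (Fin l → ℕ)) :
    Matrix (Fin l) (Fin l) ℝ :=
  fun i k => ∫ y, (y k : ℝ) ∂(p i).toMeasure

/-- Positive regularity: some power of the matrix has only positive entries. -/
def PositivelyRegular {l : ℕ} (M : Matrix (Fin l) (Fin l) ℝ) : Prop :=
  ∃ n : ℕ, ∀ i k, 0 < (M ^ n) i k

/-- `ρ` is the largest (real) eigenvalue of `M`. -/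
def IsLargestEigenvalue {l : ℕ} (M : Matrix (Fin l) (Fin l) ℝ) (ρ : ℝ) : Prop :=
  IsGreatest {x : ℝ | Module.End.HasEigenvalue (Matrix.toLin' M) x} ρ

/-- The offspring vectors of a multitype branching process with offspring laws `p`:
`Y n j i` is the offspring vector of the `i`-th individual (counted from `0`) of type `j` in
generation `n`; all these vectors are independent and `Y n j i` has law `p j`. -/
structure IsOffspringFamily {Ω : Type*} [MeasurableSpace Ω] (μ : Measure Ω) {l : ℕ}
    (p : Fin l → PMF (Fin l → ℕ)) (Y : ℕ → Fin l → ℕ → Ω → (Fin l → ℕ)) : Prop where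
  measurable : ∀ n j i, Measurable (Y n j i)
  law : ∀ n j i, μ.map (Y n j i) = (p j).toMeasure
  indep : iIndepFun (fun x : ℕ × Fin l × ℕ => Y x.1 x.2.1 x.2.2) μ

/-- The vector of population sizes of each generation, started from one individual of type
`j₀`: `Z₀ = e_{j₀}` and `Z_{n+1} = ∑_j ∑_{i < Z_{n,j}} Y n j i`. -/
def population {Ω : Type*} {l : ℕ} (Y : ℕ → Fin l → ℕ → Ω → (Fin l → ℕ)) (j₀ : Fin l) :
    ℕ → Ω → (Fin l → ℕ)
  | 0, _ => Pi.single j₀ 1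
  | n + 1, ω => ∑ j, ∑ i ∈ Finset.range (population Y j₀ n ω j), Y n j i ω

/-- A label `((j, i), (k, c))` for a non-founding individual: it is the `c`-th type-`k` child
of the `i`-th type-`j` individual of the previous generation. -/
abbrev Individual (l : ℕ) : Type := (Fin l × ℕ) × (Fin l × ℕ)

/-- The parent (type and number) of an individual; it identifies the family. -/
def Individual.parent {l : ℕ} (x : Individual l) : Fin l × ℕ := x.1

/-- The set of individuals of generation `n`, for `n ≥ 1`: the parent `(j, i)` is present in
generation `n - 1`, and has more than `c` children of type `k`. -/
def generation {Ω : Type*} {l : ℕ} (Y : ℕ → Fin l → ℕ → Ω → (Fin l → ℕ)) (j₀ : Fin l)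
    (n : ℕ) (ω : Ω) : Set (Individual l) :=
  {x | x.1.2 < population Y j₀ (n - 1) ω x.1.1 ∧ x.2.2 < Y (n - 1) x.1.1 x.1.2 ω x.2.1}

/-- `X` is a uniform random sample without replacement of `r` members of the random finite set
`G`: conditionally on `G = g`, where `g` has at least `r` elements, each of the
`|g| (|g| - 1) ⋯ (|g| - r + 1)` sequences of `r` distinct elements of `g` is drawn with the same
probability. (Nothing is asked where `G` has fewer than `r` elements: there is no such sample.) -/
structure IsSampleWithoutReplacement {Ω : Type*} [MeasurableSpace Ω] (μ : Measure Ω) {l : ℕ}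
    (G : Ω → Set (Individual l)) (r : ℕ) (X : Ω → Fin r → Individual l) : Prop where
  measurable : Measurable X
  uniform : ∀ (g : Finset (Individual l)) (a : Fin r → Individual l),
    r ≤ g.card → Function.Injective a → (∀ t, a t ∈ g) →
      μ {ω | G ω = ↑g ∧ X ω = a} = μ {ω | G ω = ↑g} / (g.card.descFactorial r : ℝ≥0∞)

/-- The non-sibling event: `X` consists of `r` members of `G`, and no two of them have the same
parent. (It fails where `G` has fewer than `r` elements.) -/
def nonSibling {Ω : Type*} {l : ℕ} (G : Ω → Set (Individual l)) {r : ℕ}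
    (X : Ω → Fin r → Individual l) : Set Ω :=
  {ω | (∀ t, X ω t ∈ G ω) ∧ ∀ t t', t ≠ t' → (X ω t).parent ≠ (X ω t').parent}

end GaltonWatson

/-! Write `N` for the size of generation `n`, `T` for that of generation `n + 1`, and `r` for the
size of the sample from the latter. Two fixed positions of the sample form a uniform pair of
distinct individuals, so a union bound over positions bounds the chance of siblings by `r²` times
the number of ordered sibling pairs over `T (T - 1)`. No individual is childless, hence `T ≥ N`, and
there are at most `∑ |Y|²` sibling pairs, the sum running over the `N` parents. Averaging over the
offspring given the past leaves a bound of order `r² C / N`. If the sample does not exist, then `N ≤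
r` and the same bound, truncated at 1, equals 1. Thus the failure probability is at most `2 E min(1,
2 r² C / N)` (`measure_nonSibling_compl_le`, with `C ≥ 1`).

For the rate, drop the truncation. The inequality between harmonic and arithmetic means gives
`E(1/N) ≤ K ^ n` (`lintegral_inv_size_population_le`), and `α < -log_ρ K` says precisely that `ρ ^ α
K < 1`.

This does not settle convergence to 1, because `K ρ` need not be below 1; there `N` must be compared
with `ρ ^ n`. Let `u` be a positive eigenvector for `ρ` (Perron–Frobenius) and `W_n = ∑ k, Z_{n,k}
u_k`. Then `W_n / ρ ^ n` is a martingale, and relative to generation `m` its squared deviation is at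
most a constant times `E(1 / W_m)`, uniformly in later generations (`lintegral_sq_weight_ratio_le`).
By Chebyshev, `|Z_{m+k}| < δ ρ ^ k` has probability at most `B K ^ m`
(`exists_measure_size_population_lt_le`). Here `K < 1` may be assumed, since one-child families do
not have full probability. Fixing a large `m` and then letting `n → ∞` finishes. Restarting at
generation `m` avoids having to show that the martingale limit is positive. -/

namespace GaltonWatson

variable {l : ℕ}

/-! ### Population vectors, their sizes and linear functionals. -/

/-- The labels `(j, i)` of the individuals of a generation with population vector `b`. -/
def labels (b : Fin l → ℕ) : Finset (Fin l × ℕ) :=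
  (Finset.univ ×ˢ Finset.range (size b)).filter fun x => x.2 < b x.1

theorem le_size (b : Fin l → ℕ) (j : Fin l) : b j ≤ size b :=
  Finset.single_le_sum (f := b) (fun _ _ => Nat.zero_le _) (Finset.mem_univ j)

@[simp]
theorem mem_labels {b : Fin l → ℕ} {x : Fin l × ℕ} : x ∈ labels b ↔ x.2 < b x.1 := by
  simp only [labels, Finset.mem_filter, Finset.mem_product, Finset.mem_univ, Finset.mem_range,
    true_and, and_iff_right_iff_imp]
  exact fun h => h.trans_le (le_size b x.1)

theorem sum_labels {A : Type*} [AddCommMonoid A] (b : Fin l → ℕ) (f : Fin l × ℕ → A) :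
    ∑ x ∈ labels b, f x = ∑ j, ∑ i ∈ Finset.range (b j), f (j, i) :=
  Finset.sum_finset_product _ _ _ (by simp)

theorem card_labels (b : Fin l → ℕ) : (labels b).card = size b := by
  rw [Finset.card_eq_sum_ones, sum_labels]
  simp [size]

/-- The population vector of the next generation, as a function of the current population
vector and of the offspring vectors. -/
def nextPopulation (b : Fin l → ℕ) (v : Fin l × ℕ → Fin l → ℕ) : Fin l → ℕ :=
  ∑ x ∈ labels b, v x

theorem size_sum {ι : Type*} (s : Finset ι) (f : ι → Fin l → ℕ) :
    size (∑ x ∈ s, f x) = ∑ x ∈ s, size (f x) := by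
  simp only [size, Finset.sum_apply]
  exact Finset.sum_comm

theorem size_nextPopulation (b : Fin l → ℕ) (v : Fin l × ℕ → Fin l → ℕ) :
    size (nextPopulation b v) = ∑ x ∈ labels b, size (v x) :=
  size_sum _ _

theorem size_le_size_nextPopulation {b : Fin l → ℕ} {v : Fin l × ℕ → Fin l → ℕ}
    (hv : ∀ x, 0 < size (v x)) : size b ≤ size (nextPopulation b v) := by
  rw [size_nextPopulation, ← card_labels, Finset.card_eq_sum_ones]
  exact Finset.sum_le_sum fun x _ => hv x

/-- Cauchy–Schwarz, or harmonic mean at most arithmetic mean, over the `size b` families. For an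
empty population both sides vanish because `0⁻¹ = 0`. -/
theorem inv_size_nextPopulation_le {b : Fin l → ℕ} {v : Fin l × ℕ → Fin l → ℕ}
    (hv : ∀ x, 0 < size (v x)) :
    ((size (nextPopulation b v) : ℕ) : ℝ)⁻¹ ≤
      ((size b : ℝ) ^ 2)⁻¹ * ∑ x ∈ labels b, (size (v x) : ℝ)⁻¹ := by
  rcases Nat.eq_zero_or_pos (size b) with hb | hb
  · have : labels b = ∅ := by rw [← Finset.card_eq_zero, card_labels, hb]
    simp [size_nextPopulation, this]
  have h := Finset.sq_sum_div_le_sum_sq_div (labels b) (fun _ => (1 : ℝ))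
    (g := fun x => (size (v x) : ℝ)) (fun x _ => by exact_mod_cast hv x)
  simp only [Finset.sum_const, card_labels, nsmul_eq_mul, mul_one, one_pow, one_div] at h
  have hb' : (0 : ℝ) < (size b : ℝ) ^ 2 := by positivity
  rw [inv_mul_eq_div, le_div_iff₀ hb', mul_comm, ← div_eq_mul_inv, size_nextPopulation]
  push_cast
  exact h

/-- The linear functional `y ↦ ∑ k, y k * u k`. -/
noncomputable def weight (u : Fin l → ℝ) (y : Fin l → ℕ) : ℝ := ∑ k, (y k : ℝ) * u k

theorem weight_nextPopulation (u : Fin l → ℝ) (b : Fin l → ℕ) (v : Fin l × ℕ → Fin l → ℕ) :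
    weight u (nextPopulation b v) = ∑ x ∈ labels b, weight u (v x) := by
  simp only [weight, nextPopulation, Finset.sum_apply, Nat.cast_sum, Finset.sum_mul]
  exact Finset.sum_comm

theorem sum_labels_fst (u : Fin l → ℝ) (b : Fin l → ℕ) :
    ∑ x ∈ labels b, u x.1 = weight u b := by
  rw [sum_labels]
  simp [weight]

theorem weight_le {u : Fin l → ℝ} {c : ℝ} (h : ∀ k, u k ≤ c) (y : Fin l → ℕ) :
    weight u y ≤ c * size y := by
  simp only [weight, size, Nat.cast_sum, Finset.mul_sum]
  refine Finset.sum_le_sum fun k _ => ?_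
  rw [mul_comm]
  exact mul_le_mul_of_nonneg_right (h k) (Nat.cast_nonneg _)

theorem le_weight {u : Fin l → ℝ} {c : ℝ} (h : ∀ k, c ≤ u k) (y : Fin l → ℕ) :
    c * size y ≤ weight u y := by
  simp only [weight, size, Nat.cast_sum, Finset.mul_sum]
  refine Finset.sum_le_sum fun k _ => ?_
  rw [mul_comm (y k : ℝ)]
  exact mul_le_mul_of_nonneg_right (h k) (Nat.cast_nonneg _)

/-- Freezing: by Fubini on the product law, an independent variable may be averaged out first. It
plays the role of conditional expectation throughout. -/
theorem lintegral_eq_lintegral_lintegral_of_indepFun {Ω α β : Type*} [MeasurableSpace Ω]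
    [MeasurableSpace α] [MeasurableSpace β] {μ : Measure Ω} [IsProbabilityMeasure μ]
    {H : Ω → α} {V : Ω → β} (hind : IndepFun H V μ) (hH : Measurable H) (hV : Measurable V)
    {g : α → β → ℝ≥0∞} (hg : Measurable (Function.uncurry g)) :
    ∫⁻ ω, g (H ω) (V ω) ∂μ = ∫⁻ ω, ∫⁻ ω', g (H ω) (V ω') ∂μ ∂μ := by
  have h := (indepFun_iff_map_prod_eq_prod_map_map hH.aemeasurable hV.aemeasurable).1 hind
  have : IsProbabilityMeasure (μ.map V) := Measure.isProbabilityMeasure_map hV.aemeasurable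
  calc ∫⁻ ω, g (H ω) (V ω) ∂μ
      = ∫⁻ z, Function.uncurry g z ∂(μ.map fun ω => (H ω, V ω)) :=
        (lintegral_map hg (hH.prodMk hV)).symm
    _ = ∫⁻ a, ∫⁻ b, g a b ∂(μ.map V) ∂(μ.map H) := by
        rw [h, lintegral_prod _ hg.aemeasurable]
        rfl
    _ = ∫⁻ ω, ∫⁻ b, g (H ω) b ∂(μ.map V) ∂μ := lintegral_map hg.lintegral_prod_right' hH
    _ = _ := lintegral_congr fun ω => lintegral_map (hg.comp measurable_prodMk_left) hV

/-! ### The past of the process, and the inverse moment of the population size. -/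

section Branching

variable {Ω : Type*} {Y : ℕ → Fin l → ℕ → Ω → (Fin l → ℕ)} {j₀ : Fin l}

/-- All offspring vectors of generation `n`. -/
def offspring (Y : ℕ → Fin l → ℕ → Ω → (Fin l → ℕ)) (n : ℕ) (ω : Ω) (x : Fin l × ℕ) :
    Fin l → ℕ :=
  Y n x.1 x.2 ω

theorem population_succ (n : ℕ) (ω : Ω) :
    population Y j₀ (n + 1) ω = nextPopulation (population Y j₀ n ω) (offspring Y n ω) := by
  rw [nextPopulation, sum_labels]
  rfl

theorem measurable_nextPopulation (b : Fin l → ℕ) : Measurable (nextPopulation b) :=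
  Finset.measurable_fun_sum _ fun x _ => measurable_pi_apply x

theorem measurable_nextPopulation_uncurry :
    Measurable fun z : (Fin l → ℕ) × (Fin l × ℕ → Fin l → ℕ) => nextPopulation z.1 z.2 :=
  measurable_from_prod_countable_right measurable_nextPopulation

namespace IsOffspringFamily

/-- The σ-algebra generated by the offspring vectors of the generations before `n`. -/
abbrev history (Y : ℕ → Fin l → ℕ → Ω → (Fin l → ℕ)) (n : ℕ) : MeasurableSpace Ω :=
  ⨆ x ∈ {x : ℕ × Fin l × ℕ | x.1 < n},
    MeasurableSpace.comap (Y x.1 x.2.1 x.2.2) inferInstance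

theorem history_mono {m n : ℕ} (h : m ≤ n) : history Y m ≤ history Y n :=
  biSup_mono fun _ hx => lt_of_lt_of_le hx h

theorem measurable_offspring_history (n : ℕ) : Measurable[history Y (n + 1)] (offspring Y n) := by
  refine @measurable_pi_lambda _ _ _ (history Y (n + 1)) _ _ fun x => ?_
  refine Measurable.mono (comap_measurable _) ?_ le_rfl
  exact le_biSup (fun x : ℕ × Fin l × ℕ =>
    MeasurableSpace.comap (Y x.1 x.2.1 x.2.2) inferInstance)
    (show (n, x.1, x.2) ∈ {x : ℕ × Fin l × ℕ | x.1 < n + 1} from Nat.lt_succ_self n)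

theorem measurable_population_history (n : ℕ) :
    Measurable[history Y n] (population Y j₀ n) := by
  induction n with
  | zero => exact @measurable_const _ _ _ (history Y 0) _
  | succ n ih =>
    have : population Y j₀ (n + 1) =
        fun ω => nextPopulation (population Y j₀ n ω) (offspring Y n ω) :=
      funext (population_succ n)
    rw [this]
    have h1 : Measurable[history Y (n + 1)] (population Y j₀ n) :=
      Measurable.mono ih (history_mono n.le_succ) le_rfl
    have h2 := @Measurable.prodMk Ω (history Y (n + 1)) _ _ _ _ _ _ h1
      (measurable_offspring_history n)
    have h3 := measurable_nextPopulation_uncurry.comp h2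
    exact h3

variable [MeasurableSpace Ω] {μ : Measure Ω} {p : Fin l → PMF (Fin l → ℕ)}

theorem history_le (hY : IsOffspringFamily μ p Y) (n : ℕ) : history Y n ≤ ‹MeasurableSpace Ω› :=
  iSup₂_le fun x _ => (hY.measurable x.1 x.2.1 x.2.2).comap_le

theorem measurable_offspring (hY : IsOffspringFamily μ p Y) (n : ℕ) :
    Measurable (offspring Y n) :=
  measurable_pi_lambda _ fun x => hY.measurable n x.1 x.2

theorem measurable_population (hY : IsOffspringFamily μ p Y) (n : ℕ) :
    Measurable (population Y j₀ n) :=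
  (measurable_population_history n).mono (hY.history_le n) le_rfl

/-- The past and generation `n` use disjoint sets of indices, `x.1 < n` and `x.1 = n`, of one
independent family. -/
theorem indepFun_offspring (hY : IsOffspringFamily μ p Y) {α : Type*} [MeasurableSpace α]
    {n : ℕ} {H : Ω → α} (hH : Measurable[history Y n] H) : IndepFun H (offspring Y n) μ := by
  have h := indep_iSup_of_disjoint (fun x => (hY.measurable x.1 x.2.1 x.2.2).comap_le)
    hY.indep.iIndep (S := {x : ℕ × Fin l × ℕ | x.1 < n}) (T := {x : ℕ × Fin l × ℕ | x.1 = n})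
    (Set.disjoint_left.2 fun x hx hx' => (ne_of_lt hx) hx')
  refine (IndepFun_iff_Indep _ _ _).2 (indep_of_indep_of_le_left (indep_of_indep_of_le_right h ?_)
    hH.comap_le)
  refine Measurable.comap_le ?_
  refine @measurable_pi_lambda _ _ _ (_) _ _ fun x => ?_
  refine Measurable.mono (comap_measurable _) ?_ le_rfl
  exact le_biSup (fun x : ℕ × Fin l × ℕ =>
    MeasurableSpace.comap (Y x.1 x.2.1 x.2.2) inferInstance)
    (show (n, x.1, x.2) ∈ {x : ℕ × Fin l × ℕ | x.1 = n} from rfl)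

theorem lintegral_offspring (hY : IsOffspringFamily μ p Y) (n : ℕ) (x : Fin l × ℕ)
    (f : (Fin l → ℕ) → ℝ≥0∞) :
    ∫⁻ ω, f (offspring Y n ω x) ∂μ = ∫⁻ y, f y ∂(p x.1).toMeasure := by
  rw [← hY.law n x.1 x.2, lintegral_map (Measurable.of_discrete) (hY.measurable n x.1 x.2)]
  rfl

theorem integral_offspring (hY : IsOffspringFamily μ p Y) (n : ℕ) (x : Fin l × ℕ)
    (f : (Fin l → ℕ) → ℝ) :
    ∫ ω, f (offspring Y n ω x) ∂μ = ∫ y, f y ∂(p x.1).toMeasure := by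
  rw [← hY.law n x.1 x.2, integral_map (hY.measurable n x.1 x.2).aemeasurable
    (Measurable.of_discrete).aestronglyMeasurable]
  rfl

theorem integrable_offspring (hY : IsOffspringFamily μ p Y) (n : ℕ) (x : Fin l × ℕ)
    {f : (Fin l → ℕ) → ℝ} (hf : Integrable f (p x.1).toMeasure) :
    Integrable (fun ω => f (offspring Y n ω x)) μ := by
  rw [← hY.law n x.1 x.2] at hf
  exact hf.comp_measurable (hY.measurable n x.1 x.2)

theorem ae_size_offspring_pos (hY : IsOffspringFamily μ p Y) (hzero : ∀ j, p j 0 = 0) (n : ℕ) :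
    ∀ᵐ ω ∂μ, ∀ x, 0 < size (offspring Y n ω x) := by
  rw [ae_all_iff]
  intro x
  have h0 : ∀ᵐ y ∂(p x.1).toMeasure, y ≠ 0 := by
    have : {y : Fin l → ℕ | ¬ y ≠ 0} = {0} := by ext; simp
    rw [ae_iff, this, PMF.toMeasure_apply_singleton _ _ (MeasurableSet.singleton _), hzero]
  rw [← hY.law n x.1 x.2] at h0
  filter_upwards [ae_of_ae_map (hY.measurable n x.1 x.2).aemeasurable h0] with ω hω
  refine Nat.pos_of_ne_zero fun h => hω ?_
  funext k
  exact Nat.le_zero.1 (h ▸ le_size (offspring Y n ω x) k)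

theorem ae_size_population_pos (hY : IsOffspringFamily μ p Y) (hzero : ∀ j, p j 0 = 0) :
    ∀ᵐ ω ∂μ, ∀ n, 0 < size (population Y j₀ n ω) := by
  filter_upwards [ae_all_iff.2 (hY.ae_size_offspring_pos hzero)] with ω hω n
  induction n with
  | zero => simp [population, size]
  | succ n ih =>
    rw [population_succ]
    exact ih.trans_le (size_le_size_nextPopulation (hω n))

/-- In the harmonic mean bound there are `size b` summands of mean at most `K`; they cancel one of
the two factors `1 / size b`. -/
theorem lintegral_inv_size_nextPopulation_le (hY : IsOffspringFamily μ p Y)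
    (hzero : ∀ j, p j 0 = 0) {K : ℝ}
    (hK : ∀ i, Integrable (fun y => (size y : ℝ)⁻¹) (p i).toMeasure ∧
      ∫ y, (size y : ℝ)⁻¹ ∂(p i).toMeasure ≤ K) (n : ℕ) (b : Fin l → ℕ) :
    ∫⁻ ω, ENNReal.ofReal (size (nextPopulation b (offspring Y n ω)) : ℝ)⁻¹ ∂μ ≤
      ENNReal.ofReal K * ENNReal.ofReal (size b : ℝ)⁻¹ := by
  calc ∫⁻ ω, ENNReal.ofReal (size (nextPopulation b (offspring Y n ω)) : ℝ)⁻¹ ∂μ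
      ≤ ∫⁻ ω, ENNReal.ofReal ((size b : ℝ) ^ 2)⁻¹ *
          ∑ x ∈ labels b, ENNReal.ofReal (size (offspring Y n ω x) : ℝ)⁻¹ ∂μ := by
        refine lintegral_mono_ae ?_
        filter_upwards [hY.ae_size_offspring_pos hzero n] with ω hω
        rw [← ENNReal.ofReal_sum_of_nonneg (fun _ _ => by positivity),
          ← ENNReal.ofReal_mul (by positivity)]
        exact ENNReal.ofReal_le_ofReal (inv_size_nextPopulation_le hω)
    _ = ENNReal.ofReal ((size b : ℝ) ^ 2)⁻¹ *
          ∑ x ∈ labels b, ∫⁻ ω, ENNReal.ofReal (size (offspring Y n ω x) : ℝ)⁻¹ ∂μ := by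
        have hm : ∀ x, Measurable fun ω => ENNReal.ofReal (size (offspring Y n ω x) : ℝ)⁻¹ :=
          fun x => Measurable.comp (g := fun y : Fin l → ℕ => ENNReal.ofReal (size y : ℝ)⁻¹)
            Measurable.of_discrete (hY.measurable n x.1 x.2)
        rw [lintegral_const_mul _ (Finset.measurable_fun_sum _ fun x _ => hm x),
          lintegral_finsetSum _ fun x _ => hm x]
    _ ≤ ENNReal.ofReal ((size b : ℝ) ^ 2)⁻¹ * ∑ x ∈ labels b, ENNReal.ofReal K := by
        gcongr with x hx
        rw [hY.lintegral_offspring n x fun y => ENNReal.ofReal (size y : ℝ)⁻¹,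
          ← ofReal_integral_eq_lintegral_ofReal (hK x.1).1 (ae_of_all _ fun y => by positivity)]
        exact ENNReal.ofReal_le_ofReal (hK x.1).2
    _ = ENNReal.ofReal K * ENNReal.ofReal (size b : ℝ)⁻¹ := by
        rw [Finset.sum_const, card_labels, nsmul_eq_mul, ← ENNReal.ofReal_natCast, ← mul_assoc,
          ← ENNReal.ofReal_mul (by positivity), mul_comm]
        congr 2
        rcases eq_or_ne (size b : ℝ) 0 with h | h
        · simp [h]
        · field_simp

variable [IsProbabilityMeasure μ]

theorem lintegral_population_offspring (hY : IsOffspringFamily μ p Y) {n : ℕ}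
    {α : Type*} [MeasurableSpace α] {H : Ω → α} (hH : Measurable[history Y n] H)
    {g : α → (Fin l × ℕ → Fin l → ℕ) → ℝ≥0∞} (hg : Measurable (Function.uncurry g)) :
    ∫⁻ ω, g (H ω) (offspring Y n ω) ∂μ = ∫⁻ ω, ∫⁻ ω', g (H ω) (offspring Y n ω') ∂μ ∂μ :=
  lintegral_eq_lintegral_lintegral_of_indepFun (hY.indepFun_offspring hH)
    (hH.mono (hY.history_le n) le_rfl) (hY.measurable_offspring n) hg

theorem lintegral_inv_size_population_le (hY : IsOffspringFamily μ p Y)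
    (hzero : ∀ j, p j 0 = 0) {K : ℝ}
    (hK : ∀ i, Integrable (fun y => (size y : ℝ)⁻¹) (p i).toMeasure ∧
      ∫ y, (size y : ℝ)⁻¹ ∂(p i).toMeasure ≤ K) (n : ℕ) :
    ∫⁻ ω, ENNReal.ofReal (size (population Y j₀ n ω) : ℝ)⁻¹ ∂μ ≤ ENNReal.ofReal K ^ n := by
  induction n with
  | zero => simp [population, size]
  | succ n ih =>
    simp only [population_succ]
    rw [hY.lintegral_population_offspring (H := population Y j₀ n)
      (g := fun b v => ENNReal.ofReal (size (nextPopulation b v) : ℝ)⁻¹)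
      (measurable_population_history n)
      (Measurable.comp (g := fun y : Fin l → ℕ => ENNReal.ofReal (size y : ℝ)⁻¹)
        Measurable.of_discrete measurable_nextPopulation_uncurry)]
    calc _ ≤ ∫⁻ ω, ENNReal.ofReal K * ENNReal.ofReal (size (population Y j₀ n ω) : ℝ)⁻¹ ∂μ :=
          lintegral_mono fun ω => hY.lintegral_inv_size_nextPopulation_le hzero hK n _
      _ ≤ ENNReal.ofReal K * ENNReal.ofReal K ^ n := by
          rw [lintegral_const_mul' _ _ ENNReal.ofReal_ne_top]
          gcongr
      _ = _ := (pow_succ' _ _).symm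

end IsOffspringFamily

end Branching

end GaltonWatson

/-! ### Siblings in a uniform sample without replacement. -/

namespace GaltonWatson

/-- Double counting by two-fold transitivity: the proportion of embeddings `e : ι ↪ α` with
`R (e t) (e t')` is the proportion of pairs of distinct elements related by `R`. -/
theorem card_embedding_filter_mul {ι α : Type*} [Fintype ι] [Fintype α] [DecidableEq ι]
    [DecidableEq α] (R : α → α → Prop) [DecidableRel R] {t t' : ι} (h : t ≠ t') :
    (Finset.univ.filter fun e : ι ↪ α => R (e t) (e t')).card *
        (Finset.univ.offDiag : Finset (α × α)).card =
      Fintype.card (ι ↪ α) *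
        ((Finset.univ.offDiag : Finset (α × α)).filter fun x => R x.1 x.2).card := by
  classical
  -- The fibre sizes of `e ↦ (e t, e t')` are all equal: a permutation of `α` carrying one pair of
  -- distinct points to another acts injectively on embeddings. The permutation is a product of two
  -- swaps.
  set c : α × α → ℕ := fun x => (Finset.univ.filter fun e : ι ↪ α => (e t, e t') = x).card
  have hle : ∀ x ∈ (Finset.univ.offDiag : Finset (α × α)),
      ∀ y ∈ (Finset.univ.offDiag : Finset (α × α)), c x ≤ c y := by
    rintro ⟨x, x'⟩ hx ⟨y, y'⟩ hy
    have hx : x ≠ x' := by simpa using hx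
    have hy : y ≠ y' := by simpa using hy
    let σ₁ := Equiv.swap x y
    have h1 : σ₁ x = y := Equiv.swap_apply_left x y
    have h1' : y ≠ σ₁ x' := fun h => hx (σ₁.injective (h1.trans h))
    let σ := σ₁.trans (Equiv.swap (σ₁ x') y')
    have hσ : σ x = y := by
      simp only [σ, Equiv.trans_apply, h1]
      exact Equiv.swap_apply_of_ne_of_ne h1' hy
    have hσ' : σ x' = y' := Equiv.swap_apply_left _ _
    refine Finset.card_le_card_of_injOn (fun e => e.trans σ.toEmbedding) ?_ ?_
    · intro e he
      simp only [Finset.coe_filter, Finset.mem_univ, true_and, Set.mem_ofPred_eq,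
        Prod.mk.injEq] at he ⊢
      simp [he.1, he.2, hσ, hσ']
    · intro e _ e' _ hee
      ext i
      have := DFunLike.congr_fun hee i
      simpa using this
  have hR : (Finset.univ.filter fun e : ι ↪ α => R (e t) (e t')).card =
      ∑ x ∈ (Finset.univ.offDiag : Finset (α × α)).filter fun x => R x.1 x.2, c x := by
    rw [Finset.card_eq_sum_card_fiberwise (f := fun e : ι ↪ α => (e t, e t'))
      (t := (Finset.univ.offDiag : Finset (α × α)).filter fun x => R x.1 x.2)]
    · refine Finset.sum_congr rfl fun x hx => ?_
      rw [Finset.filter_filter]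
      refine congrArg Finset.card (Finset.filter_congr fun e _ => ?_)
      simp only [Finset.mem_filter] at hx
      exact ⟨fun h => h.2, fun h => ⟨by rw [← h] at hx; exact hx.2, h⟩⟩
    · intro e he
      simpa [h] using he
  have hall : Fintype.card (ι ↪ α) = ∑ x ∈ (Finset.univ.offDiag : Finset (α × α)), c x := by
    rw [← Finset.card_univ, Finset.card_eq_sum_card_fiberwise (f := fun e : ι ↪ α => (e t, e t'))
      (t := (Finset.univ.offDiag : Finset (α × α)))]
    intro e _
    simpa using h
  rcases (Finset.univ.offDiag : Finset (α × α)).eq_empty_or_nonempty with h0 | ⟨x₀, h0⟩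
  · simp [h0]
  have hc : ∀ x ∈ (Finset.univ.offDiag : Finset (α × α)), c x = c x₀ :=
    fun x hx => (hle x hx x₀ h0).antisymm (hle x₀ h0 x hx)
  rw [hR, hall, Finset.sum_congr rfl hc,
    Finset.sum_congr rfl fun x hx => hc x (Finset.mem_filter.1 hx).1]
  simp only [Finset.sum_const, smul_eq_mul]
  ring

variable {l : ℕ}

/-- The ordered pairs of distinct siblings in a finite set of individuals. -/
def siblingPairs (g : Finset (Individual l)) : Finset (Individual l × Individual l) :=
  g.offDiag.filter fun x => x.1.parent = x.2.parent

/-- The injective sequences of `r` members of `g`. -/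
noncomputable def samples (g : Finset (Individual l)) (r : ℕ) : Finset (Fin r → Individual l) :=
  (Finset.univ : Finset (Fin r ↪ g)).map
    ⟨fun e t => (e t : Individual l), fun e e' h => by
      ext t : 2
      exact congrFun h t⟩

theorem mem_samples {g : Finset (Individual l)} {r : ℕ} {a : Fin r → Individual l} :
    a ∈ samples g r ↔ Function.Injective a ∧ ∀ t, a t ∈ g := by
  simp only [samples, Finset.mem_map, Finset.mem_univ, true_and]
  constructor
  · rintro ⟨e, rfl⟩
    exact ⟨fun t t' h => e.injective (Subtype.ext h), fun t => (e t).2⟩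
  · rintro ⟨hinj, hmem⟩
    exact ⟨⟨fun t => ⟨a t, hmem t⟩, fun t t' h => hinj (congrArg Subtype.val h)⟩, rfl⟩

theorem card_samples (g : Finset (Individual l)) (r : ℕ) :
    (samples g r).card = g.card.descFactorial r := by
  rw [samples, Finset.card_map, Finset.card_univ, Fintype.card_embedding_eq, Fintype.card_fin,
    Fintype.card_coe]

theorem card_samples_filter_mul (g : Finset (Individual l)) {r : ℕ} {t t' : Fin r} (h : t ≠ t') :
    ((samples g r).filter fun a => (a t).parent = (a t').parent).card *
        (g.card * (g.card - 1)) = g.card.descFactorial r * (siblingPairs g).card := by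
  have h1 := card_embedding_filter_mul (α := g) (fun x y => x.1.parent = y.1.parent) h
  have h2 : ((samples g r).filter fun a => (a t).parent = (a t').parent).card =
      (Finset.univ.filter fun e : Fin r ↪ g => (e t).1.parent = (e t').1.parent).card := by
    rw [samples, Finset.filter_map, Finset.card_map]
    rfl
  have h3 : (siblingPairs g).card = ((Finset.univ.offDiag : Finset (g × g)).filter
      fun x => x.1.1.parent = x.2.1.parent).card := by
    symm
    refine Finset.card_bij (fun x _ => (x.1.1, x.2.1)) ?_ ?_ ?_
    · rintro ⟨⟨x, hx⟩, ⟨y, hy⟩⟩ h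
      simp_all [siblingPairs]
    · rintro ⟨⟨x, hx⟩, ⟨y, hy⟩⟩ _ ⟨⟨x', hx'⟩, ⟨y', hy'⟩⟩ _ h
      simpa using h
    · rintro ⟨x, y⟩ h
      simp only [siblingPairs, Finset.mem_filter, Finset.mem_offDiag] at h
      exact ⟨(⟨x, h.1.1⟩, ⟨y, h.1.2.1⟩), by simpa using ⟨h.1.2.2, h.2⟩, rfl⟩
  rw [Finset.offDiag_card, Finset.card_univ, Fintype.card_coe, Fintype.card_embedding_eq,
    Fintype.card_fin, Fintype.card_coe] at h1
  rw [h2, h3, ← h1, Nat.mul_sub, mul_one]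

/-- Union bound over the ordered pairs of distinct positions, at most `r ^ 2` in number. -/
theorem card_samples_sibling_mul_le (g : Finset (Individual l)) (r : ℕ) :
    ((samples g r).filter fun a => ∃ t t', t ≠ t' ∧ (a t).parent = (a t').parent).card *
        (g.card * (g.card - 1)) ≤ r ^ 2 * (g.card.descFactorial r * (siblingPairs g).card) := by
  have hsub : ((samples g r).filter fun a => ∃ t t', t ≠ t' ∧ (a t).parent = (a t').parent) ⊆
      (Finset.univ.offDiag : Finset (Fin r × Fin r)).biUnion fun x =>
        (samples g r).filter fun a => (a x.1).parent = (a x.2).parent := by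
    intro a ha
    obtain ⟨ha, t, t', ht, h⟩ := Finset.mem_filter.1 ha
    exact Finset.mem_biUnion.2 ⟨(t, t'), by simpa using ht, Finset.mem_filter.2 ⟨ha, h⟩⟩
  calc _ ≤ (∑ x ∈ (Finset.univ.offDiag : Finset (Fin r × Fin r)),
        ((samples g r).filter fun a => (a x.1).parent = (a x.2).parent).card) *
          (g.card * (g.card - 1)) :=
        Nat.mul_le_mul_right _ ((Finset.card_le_card hsub).trans Finset.card_biUnion_le)
    _ = ∑ x ∈ (Finset.univ.offDiag : Finset (Fin r × Fin r)),
          g.card.descFactorial r * (siblingPairs g).card := by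
        rw [Finset.sum_mul]
        exact Finset.sum_congr rfl fun x hx =>
          card_samples_filter_mul g (Finset.mem_offDiag.1 hx).2.2
    _ ≤ _ := by
        rw [Finset.sum_const, smul_eq_mul, Finset.offDiag_card, Finset.card_univ,
          Fintype.card_fin]
        refine Nat.mul_le_mul_right _ ?_
        rw [sq]
        exact Nat.sub_le _ _

/-- A bound for the probability of siblings in a sample of size `r` from `g`. -/
noncomputable def siblingBound (r : ℕ) (g : Finset (Individual l)) : ℝ :=
  min 1 ((r : ℝ) ^ 2 * ((siblingPairs g).card / (g.card * (g.card - 1))))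

theorem card_samples_sibling_le {g : Finset (Individual l)} {r : ℕ} (hr : r ≤ g.card) :
    (((samples g r).filter fun a => ∃ t t', t ≠ t' ∧ (a t).parent = (a t').parent).card : ℝ) ≤
      g.card.descFactorial r * siblingBound r g := by
  set x := (samples g r).filter fun a => ∃ t t', t ≠ t' ∧ (a t).parent = (a t').parent
  rw [siblingBound, mul_min_of_nonneg _ _ (Nat.cast_nonneg _), mul_one]
  refine le_min ?_ ?_
  · rw [← card_samples]
    exact_mod_cast Finset.card_le_card (Finset.filter_subset _ _)
  -- With at most one individual the denominator in `siblingBound` is zero, so the bound reads 0. It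
  -- still holds, as such a sample has no two positions.
  rcases le_or_gt g.card 1 with h1 | h1
  · have hx : x = ∅ := by
      refine Finset.filter_eq_empty_iff.2 fun a _ => ?_
      rintro ⟨t, t', h, -⟩
      exact h (Fin.ext (by omega))
    simp only [hx, Finset.card_empty, Nat.cast_zero]
    rcases Nat.le_one_iff_eq_zero_or_eq_one.1 h1 with h | h <;> simp [h]
  · have h := card_samples_sibling_mul_le g r
    have h' : (x.card : ℝ) * (g.card * (g.card - 1)) ≤
        r ^ 2 * (g.card.descFactorial r * (siblingPairs g).card) := by
      have hc : ((g.card - 1 : ℕ) : ℝ) = g.card - 1 := by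
        rw [Nat.cast_sub h1.le, Nat.cast_one]
      rw [← hc]
      exact_mod_cast h
    have h2 : (1 : ℝ) < g.card := by exact_mod_cast h1
    have hpos : (0 : ℝ) < g.card * (g.card - 1) := mul_pos (by linarith) (by linarith)
    rw [← mul_div_assoc, ← mul_div_assoc, le_div_iff₀ hpos]
    exact h'.trans_eq (by ring)

section Sample

variable {Ω : Type*} [MeasurableSpace Ω] {μ : Measure Ω} [IsProbabilityMeasure μ]
  {G : Ω → Finset (Individual l)} {r : ℕ} {X : Ω → Fin r → Individual l}

/-- The admissible samples have equal mass and together exhaust `{G = g}`, so the failure event is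
estimated by removing the sibling-free samples. This also absorbs the null set where `X` is not an
injective sequence in `g`, and needs no measurability of the failure event. -/
theorem measure_eq_inter_nonSibling_compl_le (hG : ∀ g, MeasurableSet {ω | G ω = g})
    (hX : IsSampleWithoutReplacement μ (fun ω => ↑(G ω)) r X) {g : Finset (Individual l)}
    (hr : r ≤ g.card) :
    μ ({ω | G ω = g} ∩ (nonSibling (fun ω => ↑(G ω)) X)ᶜ) ≤
      ENNReal.ofReal (siblingBound r g) * μ {ω | G ω = g} := by
  classical
  set d : ℝ≥0∞ := (g.card.descFactorial r : ℝ≥0∞)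
  have hd0 : d ≠ 0 := by
    simp only [d, ne_eq, Nat.cast_eq_zero, Nat.descFactorial_eq_zero_iff_lt, not_lt]
    exact hr
  have hdt : d ≠ ⊤ := ENNReal.natCast_ne_top _
  let A : (Fin r → Individual l) → Set Ω := fun a => {ω | G ω = g ∧ X ω = a}
  have hA : ∀ a, MeasurableSet (A a) := fun a =>
    (hG g).inter (hX.measurable (MeasurableSet.singleton a))
  have hAdisj : ∀ s : Finset (Fin r → Individual l), (s : Set _).PairwiseDisjoint A :=
    fun s a _ b _ hab => Set.disjoint_left.2 fun ω h h' => hab (h.2.symm.trans h'.2)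
  have hAμ : ∀ a ∈ samples g r, μ (A a) = μ {ω | G ω = g} / d := by
    intro a ha
    rw [mem_samples] at ha
    have h := hX.uniform g a hr ha.1 ha.2
    simpa only [Finset.coe_inj] using h
  let P : (Fin r → Individual l) → Prop := fun a => ∃ t t', t ≠ t' ∧ (a t).parent = (a t').parent
  have hsub : {ω | G ω = g} ∩ (nonSibling (fun ω => ↑(G ω)) X)ᶜ ⊆
      {ω | G ω = g} \ ⋃ a ∈ (samples g r).filter (fun a => ¬ P a), A a := by
    rintro ω ⟨hω, hn⟩
    refine ⟨hω, fun h => hn ?_⟩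
    simp only [Set.mem_iUnion] at h
    obtain ⟨a, ha, hωa⟩ := h
    obtain ⟨ha, hPa⟩ := Finset.mem_filter.1 ha
    have hXa : X ω = a := hωa.2
    have hg : G ω = g := hω
    refine ⟨fun t => ?_, fun t t' ht hp => hPa ⟨t, t', ht, ?_⟩⟩
    · rw [hXa]
      beta_reduce
      rw [hg]
      exact (mem_samples.1 ha).2 t
    · rwa [hXa] at hp
  have hBsub : (⋃ a ∈ (samples g r).filter (fun a => ¬ P a), A a) ⊆ {ω | G ω = g} :=
    Set.iUnion₂_subset fun a _ ω h => h.1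
  have hBm : MeasurableSet (⋃ a ∈ (samples g r).filter (fun a => ¬ P a), A a) :=
    Finset.measurableSet_biUnion _ fun a _ => hA a
  have hB : μ (⋃ a ∈ (samples g r).filter (fun a => ¬ P a), A a) =
      ((samples g r).filter (fun a => ¬ P a)).card * (μ {ω | G ω = g} / d) := by
    rw [measure_biUnion_finset (hAdisj _) fun a _ => hA a,
      Finset.sum_congr rfl fun a ha => hAμ a (Finset.mem_filter.1 ha).1, Finset.sum_const,
      nsmul_eq_mul]
  have htot : μ {ω | G ω = g} =
      ((samples g r).filter P).card * (μ {ω | G ω = g} / d) +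
        ((samples g r).filter (fun a => ¬ P a)).card * (μ {ω | G ω = g} / d) := by
    rw [← add_mul, ← Nat.cast_add, Finset.card_filter_add_card_filter_not, card_samples,
      ENNReal.mul_div_cancel hd0 hdt]
  calc _ ≤ μ ({ω | G ω = g} \ ⋃ a ∈ (samples g r).filter (fun a => ¬ P a), A a) :=
        measure_mono hsub
    _ = μ {ω | G ω = g} - ((samples g r).filter (fun a => ¬ P a)).card *
          (μ {ω | G ω = g} / d) := by
        rw [measure_sdiff hBsub hBm.nullMeasurableSet (measure_ne_top _ _), hB]
    _ ≤ ((samples g r).filter P).card * (μ {ω | G ω = g} / d) :=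
        tsub_le_iff_right.2 htot.le
    _ ≤ (d * ENNReal.ofReal (siblingBound r g)) * (μ {ω | G ω = g} / d) := by
        gcongr
        have h := ENNReal.ofReal_le_ofReal (card_samples_sibling_le hr)
        rw [ENNReal.ofReal_natCast, ENNReal.ofReal_mul (Nat.cast_nonneg _),
          ENNReal.ofReal_natCast] at h
        exact h
    _ = _ := by
        rw [mul_comm d, mul_assoc, ENNReal.mul_div_cancel hd0 hdt]

theorem measure_inter_nonSibling_compl_le (hG : ∀ g, MeasurableSet {ω | G ω = g})
    (hX : IsSampleWithoutReplacement μ (fun ω => ↑(G ω)) r X) :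
    μ ({ω | r ≤ (G ω).card} ∩ (nonSibling (fun ω => ↑(G ω)) X)ᶜ) ≤
      ∫⁻ ω, ENNReal.ofReal (siblingBound r (G ω)) ∂μ := by
  have hcover : (⋃ g, {ω | G ω = g}) = Set.univ := by
    ext ω
    simp
  have hdisj : Pairwise (Function.onFun Disjoint fun g => {ω | G ω = g}) :=
    fun g g' h => Set.disjoint_left.2 fun ω h1 h2 => h (h1.symm.trans h2)
  calc _ ≤ μ (⋃ g, {ω | r ≤ (G ω).card} ∩ (nonSibling (fun ω => ↑(G ω)) X)ᶜ ∩
        {ω | G ω = g}) := by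
        rw [← Set.inter_iUnion, hcover, Set.inter_univ]
    _ ≤ ∑' g, μ ({ω | r ≤ (G ω).card} ∩ (nonSibling (fun ω => ↑(G ω)) X)ᶜ ∩ {ω | G ω = g}) :=
        measure_iUnion_le _
    _ ≤ ∑' g, ∫⁻ ω in {ω | G ω = g}, ENNReal.ofReal (siblingBound r (G ω)) ∂μ := by
        refine ENNReal.tsum_le_tsum fun g => ?_
        rw [setLIntegral_congr_fun (g := fun _ => ENNReal.ofReal (siblingBound r g)) (hG g)
          fun ω hω => by rw [show G ω = g from hω], setLIntegral_const]
        by_cases hr : r ≤ g.card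
        · refine (measure_mono ?_).trans (measure_eq_inter_nonSibling_compl_le hG hX hr)
          exact fun ω hω => ⟨hω.2, hω.1.2⟩
        · refine (measure_mono_null (t := ∅) ?_ measure_empty).le.trans zero_le
          rintro ω ⟨⟨h, -⟩, hg⟩
          exact hr ((show G ω = g from hg) ▸ h)
    _ = _ := by
        rw [← lintegral_iUnion hG hdisj, hcover, setLIntegral_univ]

end Sample

end GaltonWatson

/-! ### A positive eigenvector, by the Collatz–Wielandt variational principle. -/

namespace GaltonWatson

variable {l : ℕ}

theorem mulVec_pos_of_pos {A : Matrix (Fin l) (Fin l) ℝ} (hA : ∀ i k, 0 < A i k)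
    {x : Fin l → ℝ} (hx : ∀ i, 0 ≤ x i) (hx0 : x ≠ 0) (i : Fin l) : 0 < A.mulVec x i := by
  obtain ⟨k, hk⟩ := Function.ne_iff.1 hx0
  exact Finset.sum_pos' (fun j _ => mul_nonneg (hA i j).le (hx j))
    ⟨k, Finset.mem_univ k, mul_pos (hA i k) ((hx k).lt_of_ne' hk)⟩

/-- The largest eigenvalue of a positively regular matrix with nonnegative entries has an
eigenvector with positive entries (Perron–Frobenius). -/
theorem IsLargestEigenvalue.exists_pos_eigenvector {M : Matrix (Fin l) (Fin l) ℝ}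
    (hM : ∀ i k, 0 ≤ M i k) (hreg : PositivelyRegular M) {ρ : ℝ}
    (hρ : IsLargestEigenvalue M ρ) (hρ0 : 0 < ρ) :
    ∃ u : Fin l → ℝ, (∀ k, 0 < u k) ∧ M.mulVec u = ρ • u := by
  obtain ⟨n, hn⟩ := hreg
  have hcomm : ∀ x, M.mulVec ((M ^ n).mulVec x) = (M ^ n).mulVec (M.mulVec x) := fun x => by
    rw [Matrix.mulVec_mulVec, Matrix.mulVec_mulVec, ← pow_succ, ← pow_succ']
  -- The eigenvector is found by maximising `s` subject to `s x ≤ M x` with `x` in the simplex. The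
  -- upper limit on `s` only serves compactness: `hscale` shows that the other constraints imply it.
  let S : Set ((Fin l → ℝ) × ℝ) := (stdSimplex ℝ (Fin l) ×ˢ Set.Icc 0 (∑ i, ∑ k, M i k)) ∩
    {z | ∀ i, z.2 * z.1 i ≤ M.mulVec z.1 i}
  have hScompact : IsCompact S := by
    refine ((isCompact_stdSimplex ℝ (Fin l)).prod isCompact_Icc).inter_right ?_
    have : {z : (Fin l → ℝ) × ℝ | ∀ i, z.2 * z.1 i ≤ M.mulVec z.1 i} =
        ⋂ i, {z | z.2 * z.1 i ≤ M.mulVec z.1 i} := by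
      ext z
      simp
    rw [this]
    refine isClosed_iInter fun i => isClosed_le (by fun_prop) ?_
    simp only [Matrix.mulVec, dotProduct]
    fun_prop
  have hscale : ∀ (y : Fin l → ℝ) (t : ℝ), (∀ i, 0 ≤ y i) → y ≠ 0 → 0 ≤ t →
      (∀ i, t * y i ≤ M.mulVec y i) → ((∑ i, y i)⁻¹ • y, t) ∈ S := by
    intro y t hy hy0 ht hty
    have hpos : 0 < ∑ i, y i := by
      obtain ⟨k, hk⟩ := Function.ne_iff.1 hy0
      exact Finset.sum_pos' (fun j _ => hy j) ⟨k, Finset.mem_univ k, (hy k).lt_of_ne' hk⟩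
    have hle : ∀ k, y k ≤ ∑ i, y i := fun k =>
      Finset.single_le_sum (fun i _ => hy i) (Finset.mem_univ k)
    have htB : t ≤ ∑ i, ∑ k, M i k := by
      refine le_of_mul_le_mul_right ?_ hpos
      rw [Finset.mul_sum, Finset.sum_mul]
      refine Finset.sum_le_sum fun i _ => (hty i).trans ?_
      rw [Finset.sum_mul, Matrix.mulVec, dotProduct]
      exact Finset.sum_le_sum fun k _ => mul_le_mul_of_nonneg_left (hle k) (hM i k)
    refine ⟨⟨⟨fun i => ?_, ?_⟩, ht, htB⟩, fun i => ?_⟩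
    · exact mul_nonneg (inv_nonneg.2 hpos.le) (hy i)
    · simp only [Pi.smul_apply, smul_eq_mul]
      rw [← Finset.mul_sum, inv_mul_cancel₀ hpos.ne']
    · simp only [Matrix.mulVec_smul, Pi.smul_apply, smul_eq_mul]
      rw [mul_left_comm]
      exact mul_le_mul_of_nonneg_left (hty i) (inv_nonneg.2 hpos.le)
  obtain ⟨v, hv⟩ := hρ.1.exists_hasEigenvector
  have hv1 : M.mulVec v = ρ • v := by
    rw [← Matrix.toLin'_apply]
    exact hv.apply_eq_smul
  -- By the triangle inequality the absolute values of an eigenvector for `ρ` are feasible, so the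
  -- maximum is at least `ρ`.
  have hvS := hscale (fun i => |v i|) ρ (fun i => abs_nonneg _)
    (fun h => hv.2 (funext fun i => abs_eq_zero.1 (congrFun h i))) hρ0.le fun i => by
      have h := congrFun hv1 i
      simp only [Pi.smul_apply, smul_eq_mul] at h
      change ρ * |v i| ≤ _
      have h' : ρ * |v i| = |ρ * v i| := by rw [abs_mul, abs_of_pos hρ0]
      rw [h', ← h, Matrix.mulVec, Matrix.mulVec, dotProduct, dotProduct]
      refine (Finset.abs_sum_le_sum_abs _ _).trans_eq (Finset.sum_congr rfl fun k _ => ?_)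
      rw [abs_mul, abs_of_nonneg (hM i k)]
  obtain ⟨⟨x, s⟩, hxs, hmax⟩ := hScompact.exists_isMaxOn ⟨_, hvS⟩ continuous_snd.continuousOn
  have hmax' : ∀ z ∈ S, z.2 ≤ s := fun z hz => hmax hz
  obtain ⟨⟨⟨hx, hx1⟩, hs0, -⟩, hsx⟩ := hxs
  simp only at hx hx1 hs0 hsx
  have hρs : ρ ≤ s := hmax' _ hvS
  have hx0 : x ≠ 0 := by
    rintro rfl
    simp at hx1
  -- If the slack `M x - s x` were nonzero, the positive power of `M` would make it positive in
  -- every coordinate, and `(M ^ n) x` would be feasible with `s + ε`.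
  have heig : M.mulVec x = s • x := by
    by_contra hne
    have hd0 : M.mulVec x - s • x ≠ 0 := sub_ne_zero.2 hne
    have hd := mulVec_pos_of_pos hn (x := M.mulVec x - s • x)
      (fun i => sub_nonneg.2 (hsx i)) hd0
    have hx' := mulVec_pos_of_pos hn hx hx0
    have : Nonempty (Fin l) := (Function.ne_iff.1 hx0).nonempty
    obtain ⟨i₀, hi₀⟩ := Finite.exists_min fun i =>
      (M ^ n).mulVec (M.mulVec x - s • x) i / (M ^ n).mulVec x i
    set ε := (M ^ n).mulVec (M.mulVec x - s • x) i₀ / (M ^ n).mulVec x i₀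
    have hε : 0 < ε := div_pos (hd i₀) (hx' i₀)
    have h := hmax' _ (hscale ((M ^ n).mulVec x) (s + ε) (fun i => (hx' i).le)
      (fun h => (hx' i₀).ne' (congrFun h i₀)) (by linarith) fun i => by
        have h1 := (le_div_iff₀ (hx' i)).1 (hi₀ i)
        rw [Matrix.mulVec_sub, Matrix.mulVec_smul] at h1
        simp only [Pi.sub_apply, Pi.smul_apply, smul_eq_mul] at h1
        rw [hcomm]
        linarith)
    simp only at h
    linarith
  have hsρ : s ≤ ρ := by
    refine hρ.2 (Module.End.hasEigenvalue_of_hasEigenvector (x := x) ⟨?_, hx0⟩)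
    rw [Module.End.mem_eigenspace_iff, Matrix.toLin'_apply, heig]
  -- Positivity of `x` comes from `s ^ n • x = (M ^ n) x`, whose entries are positive.
  have hpow : ∀ k : ℕ, (M ^ k).mulVec x = s ^ k • x := by
    intro k
    induction k with
    | zero => simp
    | succ k ih =>
      rw [pow_succ, ← Matrix.mulVec_mulVec, heig, Matrix.mulVec_smul, ih, smul_smul, pow_succ']
  refine ⟨x, fun k => ?_, ?_⟩
  · have h := mulVec_pos_of_pos hn hx hx0 k
    rw [hpow] at h
    exact pos_of_mul_pos_right h (pow_nonneg hs0 n)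
  · rw [heig, le_antisymm hsρ hρs]

end GaltonWatson

/-! ### Growth of the population at rate `ρ`, by second moments. -/

namespace GaltonWatson

variable {l : ℕ}

theorem weight_nonneg {u : Fin l → ℝ} (h0 : ∀ k, 0 ≤ u k) (y : Fin l → ℕ) : 0 ≤ weight u y :=
  Finset.sum_nonneg fun k _ => mul_nonneg (Nat.cast_nonneg _) (h0 k)

theorem abs_weight_le {u : Fin l → ℝ} {c : ℝ} (h0 : ∀ k, 0 ≤ u k) (h : ∀ k, u k ≤ c)
    (y : Fin l → ℕ) : |weight u y| ≤ c * size y := by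
  rw [abs_of_nonneg (weight_nonneg h0 y)]
  exact weight_le h y

theorem integrable_coord {ν : Measure (Fin l → ℕ)}
    (hν : Integrable (fun y => (size y : ℝ) ^ 2) ν) (k : Fin l) :
    Integrable (fun y => (y k : ℝ)) ν := by
  refine hν.mono' Measurable.of_discrete.aestronglyMeasurable (ae_of_all _ fun y => ?_)
  rw [Real.norm_of_nonneg (Nat.cast_nonneg _)]
  exact_mod_cast (le_size y k).trans (Nat.le_self_pow two_ne_zero _)

theorem memLp_weight {ν : Measure (Fin l → ℕ)}
    (hν : Integrable (fun y => (size y : ℝ) ^ 2) ν) {u : Fin l → ℝ} {c : ℝ}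
    (h0 : ∀ k, 0 ≤ u k) (h : ∀ k, u k ≤ c) : MemLp (weight u) 2 ν := by
  rw [memLp_two_iff_integrable_sq Measurable.of_discrete.aestronglyMeasurable]
  refine (hν.const_mul (c ^ 2)).mono' Measurable.of_discrete.aestronglyMeasurable
    (ae_of_all _ fun y => ?_)
  rw [Real.norm_of_nonneg (sq_nonneg _), ← mul_pow, ← sq_abs]
  exact pow_le_pow_left₀ (abs_nonneg _) (abs_weight_le h0 h y) 2

theorem integral_sq_weight_le {ν : Measure (Fin l → ℕ)}
    (hν : Integrable (fun y => (size y : ℝ) ^ 2) ν) {u : Fin l → ℝ} {c : ℝ}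
    (h0 : ∀ k, 0 ≤ u k) (h : ∀ k, u k ≤ c) :
    ∫ y, weight u y ^ 2 ∂ν ≤ c ^ 2 * ∫ y, (size y : ℝ) ^ 2 ∂ν := by
  rw [← integral_const_mul]
  refine integral_mono (memLp_weight hν h0 h).integrable_sq (hν.const_mul _) fun y => ?_
  simp only
  rw [← mul_pow, ← sq_abs]
  exact pow_le_pow_left₀ (abs_nonneg _) (abs_weight_le h0 h y) 2

theorem integral_weight {p : Fin l → PMF (Fin l → ℕ)}
    (hint : ∀ i, Integrable (fun y => (size y : ℝ) ^ 2) (p i).toMeasure) (u : Fin l → ℝ)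
    (i : Fin l) :
    ∫ y, weight u y ∂(p i).toMeasure = (reproductionMatrix p).mulVec u i := by
  simp only [weight]
  rw [integral_finsetSum _ fun k _ => (integrable_coord (hint i) k).mul_const _]
  refine Finset.sum_congr rfl fun k _ => ?_
  rw [integral_mul_const]
  rfl

theorem reproductionMatrix_nonneg (p : Fin l → PMF (Fin l → ℕ)) (i k : Fin l) :
    0 ≤ reproductionMatrix p i k :=
  integral_nonneg fun _ => Nat.cast_nonneg _

namespace IsOffspringFamily

variable {Ω : Type*} {Y : ℕ → Fin l → ℕ → Ω → (Fin l → ℕ)} {j₀ : Fin l}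

theorem measurable_population_pair_history (m k : ℕ) :
    Measurable[history Y (m + k)] fun ω => (population Y j₀ m ω, population Y j₀ (m + k) ω) := by
  have h1 : Measurable[history Y (m + k)] (population Y j₀ m) :=
    Measurable.mono (measurable_population_history m) (history_mono (Nat.le_add_right m k)) le_rfl
  exact @Measurable.prodMk Ω (history Y (m + k)) _ _ _ _ _ _ h1
    (measurable_population_history (m + k))

variable [MeasurableSpace Ω] {μ : Measure Ω} {p : Fin l → PMF (Fin l → ℕ)} {C c ρ : ℝ}
  {u : Fin l → ℝ}

theorem memLp_weight_offspring (hY : IsOffspringFamily μ p Y)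
    (hint : ∀ i, Integrable (fun y => (size y : ℝ) ^ 2) (p i).toMeasure)
    (h0 : ∀ k, 0 ≤ u k) (h : ∀ k, u k ≤ c) (n : ℕ) (x : Fin l × ℕ) :
    MemLp (fun ω => weight u (offspring Y n ω x)) 2 μ := by
  have := memLp_weight (hint x.1) h0 h
  rw [← hY.law n x.1 x.2] at this
  exact this.comp_of_map (hY.measurable n x.1 x.2).aemeasurable

theorem memLp_weight_nextPopulation (hY : IsOffspringFamily μ p Y)
    (hint : ∀ i, Integrable (fun y => (size y : ℝ) ^ 2) (p i).toMeasure)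
    (h0 : ∀ k, 0 ≤ u k) (h : ∀ k, u k ≤ c) (n : ℕ) (b : Fin l → ℕ) :
    MemLp (fun ω => weight u (nextPopulation b (offspring Y n ω))) 2 μ := by
  simp only [weight_nextPopulation]
  exact memLp_finsetSum _ fun x _ => hY.memLp_weight_offspring hint h0 h n x

/-- Markov's inequality for the squared deviation. Since `d * size ≤ weight ≤ c * size` and
generation `m` has weight at least `d`, the threshold `d / (2 * c) * ρ ^ k` forces the normalized
ratio below `1 / 2`, hence the square above `1 / 4`. -/
theorem measure_size_population_lt_le_lintegral (hY : IsOffspringFamily μ p Y)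
    (hzero : ∀ j, p j 0 = 0) {d : ℝ} (hd : 0 < d) (h0 : ∀ k, d ≤ u k) (h : ∀ k, u k ≤ c)
    (hc : 0 < c) (hρ0 : 0 < ρ) (m k : ℕ) :
    μ {ω | (size (population Y j₀ (m + k) ω) : ℝ) < d / (2 * c) * ρ ^ k} ≤
      (∫⁻ ω, ENNReal.ofReal (((ρ ^ k * weight u (population Y j₀ m ω))⁻¹ *
        weight u (population Y j₀ (m + k) ω) - 1) ^ 2) ∂μ) / ENNReal.ofReal (1 / 4) := by
  have hfm : AEMeasurable (fun ω => ENNReal.ofReal (((ρ ^ k *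
      weight u (population Y j₀ m ω))⁻¹ * weight u (population Y j₀ (m + k) ω) - 1) ^ 2)) μ :=
    (Measurable.comp (g := fun z : (Fin l → ℕ) × (Fin l → ℕ) =>
      ENNReal.ofReal (((ρ ^ k * weight u z.1)⁻¹ * weight u z.2 - 1) ^ 2)) Measurable.of_discrete
        ((hY.measurable_population (j₀ := j₀) m).prodMk
          (hY.measurable_population (m + k)))).aemeasurable
  refine le_trans (measure_mono_ae ?_) (meas_ge_le_lintegral_div hfm
    (ENNReal.ofReal_pos.2 (by norm_num : (0 : ℝ) < 1 / 4)).ne' ENNReal.ofReal_ne_top)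
  filter_upwards [hY.ae_size_population_pos (j₀ := j₀) hzero] with ω hω hlt
  refine ENNReal.ofReal_le_ofReal ?_
  have hs : (1 : ℝ) ≤ size (population Y j₀ m ω) := by exact_mod_cast hω m
  have hw : d ≤ weight u (population Y j₀ m ω) :=
    (le_mul_of_one_le_right hd.le hs).trans (le_weight h0 _)
  have hw' : weight u (population Y j₀ (m + k) ω) ≤
      1 / 2 * (ρ ^ k * weight u (population Y j₀ m ω)) := by
    calc _ ≤ c * size (population Y j₀ (m + k) ω) := weight_le h _
      _ ≤ c * (d / (2 * c) * ρ ^ k) := mul_le_mul_of_nonneg_left (le_of_lt hlt) hc.le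
      _ = 1 / 2 * (ρ ^ k * d) := by field_simp
      _ ≤ _ := by gcongr
  have hratio : (ρ ^ k * weight u (population Y j₀ m ω))⁻¹ *
      weight u (population Y j₀ (m + k) ω) ≤ 1 / 2 := by
    rw [inv_mul_eq_div]
    exact (div_le_iff₀ (mul_pos (by positivity) (hd.trans_le hw))).2 hw'
  nlinarith

variable [IsProbabilityMeasure μ]

theorem integral_weight_nextPopulation (hY : IsOffspringFamily μ p Y)
    (hint : ∀ i, Integrable (fun y => (size y : ℝ) ^ 2) (p i).toMeasure)
    (h0 : ∀ k, 0 ≤ u k) (h : ∀ k, u k ≤ c) (hu : (reproductionMatrix p).mulVec u = ρ • u)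
    (n : ℕ) (b : Fin l → ℕ) :
    ∫ ω, weight u (nextPopulation b (offspring Y n ω)) ∂μ = ρ * weight u b := by
  simp only [weight_nextPopulation]
  rw [integral_finsetSum _ fun x _ =>
    (hY.memLp_weight_offspring hint h0 h n x).integrable one_le_two]
  simp only [hY.integral_offspring n _ (weight u), integral_weight hint, hu, Pi.smul_apply,
    smul_eq_mul]
  rw [← Finset.mul_sum, sum_labels_fst]

/-- Distinct families are independent, so variances add, and each is at most a second moment. -/
theorem variance_weight_nextPopulation_le (hY : IsOffspringFamily μ p Y)
    (hC : ∀ i, Integrable (fun y => (size y : ℝ) ^ 2) (p i).toMeasure ∧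
      ∫ y, (size y : ℝ) ^ 2 ∂(p i).toMeasure ≤ C)
    (h0 : ∀ k, 0 ≤ u k) (h : ∀ k, u k ≤ c) (n : ℕ) (b : Fin l → ℕ) :
    Var[fun ω => weight u (nextPopulation b (offspring Y n ω)); μ] ≤ c ^ 2 * C * size b := by
  have hint := fun i => (hC i).1
  have hsum : (fun ω => weight u (nextPopulation b (offspring Y n ω))) =
      ∑ x ∈ labels b, fun ω => weight u (offspring Y n ω x) := by
    funext ω
    rw [weight_nextPopulation, Finset.sum_apply]
  rw [hsum, IndepFun.variance_sum fun x _ => hY.memLp_weight_offspring hint h0 h n x]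
  · calc _ ≤ ∑ x ∈ labels b, c ^ 2 * C := by
          refine Finset.sum_le_sum fun x _ => ?_
          refine (variance_le_expectation_sq
            (hY.memLp_weight_offspring hint h0 h n x).aestronglyMeasurable).trans ?_
          simp only [Pi.pow_apply]
          rw [hY.integral_offspring n x fun y => weight u y ^ 2]
          exact (integral_sq_weight_le (hint x.1) h0 h).trans
            (mul_le_mul_of_nonneg_left (hC x.1).2 (sq_nonneg c))
      _ = _ := by rw [Finset.sum_const, card_labels, nsmul_eq_mul, mul_comm]
  · intro x _ x' _ hx
    have hne : (n, x.1, x.2) ≠ (n, x'.1, x'.2) := fun h => hx (Prod.mk.inj h).2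
    exact (hY.indep.indepFun hne).comp (φ := weight u) (ψ := weight u)
      Measurable.of_discrete Measurable.of_discrete

/-- Squared bias plus variance; the eigenvector equation evaluates the mean. -/
theorem lintegral_sq_weight_nextPopulation_le (hY : IsOffspringFamily μ p Y)
    (hC : ∀ i, Integrable (fun y => (size y : ℝ) ^ 2) (p i).toMeasure ∧
      ∫ y, (size y : ℝ) ^ 2 ∂(p i).toMeasure ≤ C)
    (h0 : ∀ k, 0 ≤ u k) (h : ∀ k, u k ≤ c) (hu : (reproductionMatrix p).mulVec u = ρ • u)
    (n : ℕ) (b : Fin l → ℕ) (s : ℝ) :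
    ∫⁻ ω, ENNReal.ofReal ((s * weight u (nextPopulation b (offspring Y n ω)) - 1) ^ 2) ∂μ ≤
      ENNReal.ofReal ((s * (ρ * weight u b) - 1) ^ 2 + s ^ 2 * (c ^ 2 * C * size b)) := by
  have hA := hY.memLp_weight_nextPopulation (fun i => (hC i).1) h0 h n b
  have hD : MemLp (fun ω => s * weight u (nextPopulation b (offspring Y n ω)) - 1) 2 μ :=
    (hA.const_mul s).sub (memLp_const 1)
  rw [← ofReal_integral_eq_lintegral_ofReal hD.integrable_sq (ae_of_all _ fun _ => sq_nonneg _)]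
  refine ENNReal.ofReal_le_ofReal ?_
  have hvar := variance_eq_sub hD
  rw [variance_sub_const (hA.const_mul s).aestronglyMeasurable, variance_const_mul,
    integral_sub ((hA.const_mul s).integrable one_le_two) (integrable_const _),
    integral_const_mul, hY.integral_weight_nextPopulation (fun i => (hC i).1) h0 h hu] at hvar
  simp only [Pi.pow_apply, integral_const, probReal_univ, smul_eq_mul, mul_one] at hvar
  have := mul_le_mul_of_nonneg_left (hY.variance_weight_nextPopulation_le hC h0 h n b)
    (sq_nonneg s)
  linarith

theorem lintegral_weight_nextPopulation (hY : IsOffspringFamily μ p Y)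
    (hint : ∀ i, Integrable (fun y => (size y : ℝ) ^ 2) (p i).toMeasure)
    (h0 : ∀ k, 0 ≤ u k) (h : ∀ k, u k ≤ c) (hu : (reproductionMatrix p).mulVec u = ρ • u)
    (n : ℕ) (b : Fin l → ℕ) :
    ∫⁻ ω, ENNReal.ofReal (weight u (nextPopulation b (offspring Y n ω))) ∂μ =
      ENNReal.ofReal (ρ * weight u b) := by
  rw [← hY.integral_weight_nextPopulation hint h0 h hu n b, ofReal_integral_eq_lintegral_ofReal
    ((hY.memLp_weight_nextPopulation hint h0 h n b).integrable one_le_two)]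
  exact ae_of_all _ fun ω => weight_nonneg h0 _

/-- One step is averaged given the past of generation `m + k`, with generation `m` retained because
the later estimates normalize by its weight. -/
theorem lintegral_population_pair (hY : IsOffspringFamily μ p Y) (m k : ℕ)
    (f : (Fin l → ℕ) → (Fin l → ℕ) → ℝ≥0∞) :
    ∫⁻ ω, f (population Y j₀ m ω) (population Y j₀ (m + (k + 1)) ω) ∂μ =
      ∫⁻ ω, ∫⁻ ω', f (population Y j₀ m ω)
        (nextPopulation (population Y j₀ (m + k) ω) (offspring Y (m + k) ω')) ∂μ ∂μ := by
  simp only [← add_assoc, population_succ]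
  refine hY.lintegral_population_offspring (n := m + k)
    (H := fun ω => (population Y j₀ m ω, population Y j₀ (m + k) ω))
    (g := fun a v => f a.1 (nextPopulation a.2 v)) (measurable_population_pair_history m k) ?_
  exact measurable_from_prod_countable_right fun a =>
    Measurable.comp (g := f a.1) Measurable.of_discrete (measurable_nextPopulation a.2)

/-- The martingale property, weighted by a function of generation `m`. It evaluates the variance
increments in the next estimate. -/
theorem lintegral_weight_div_sq (hY : IsOffspringFamily μ p Y)
    (hint : ∀ i, Integrable (fun y => (size y : ℝ) ^ 2) (p i).toMeasure)
    (h0 : ∀ k, 0 ≤ u k) (h : ∀ k, u k ≤ c) (hρ : 0 ≤ ρ)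
    (hu : (reproductionMatrix p).mulVec u = ρ • u) (m k : ℕ) :
    ∫⁻ ω, ENNReal.ofReal ((weight u (population Y j₀ m ω) ^ 2)⁻¹) *
        ENNReal.ofReal (weight u (population Y j₀ (m + k) ω)) ∂μ =
      ENNReal.ofReal (ρ ^ k) *
        ∫⁻ ω, ENNReal.ofReal (weight u (population Y j₀ m ω))⁻¹ ∂μ := by
  induction k with
  | zero =>
    simp only [pow_zero, ENNReal.ofReal_one, one_mul, add_zero]
    refine lintegral_congr fun ω => ?_
    rw [← ENNReal.ofReal_mul (by positivity)]
    congr 1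
    rcases eq_or_ne (weight u (population Y j₀ m ω)) 0 with h | h
    · simp [h]
    · field_simp
  | succ k ih =>
    rw [hY.lintegral_population_pair m k fun a b =>
      ENNReal.ofReal ((weight u a ^ 2)⁻¹) * ENNReal.ofReal (weight u b)]
    rw [pow_succ', ENNReal.ofReal_mul hρ, mul_assoc, ← ih,
      ← lintegral_const_mul' _ _ ENNReal.ofReal_ne_top]
    refine lintegral_congr fun ω => ?_
    rw [lintegral_const_mul' _ _ ENNReal.ofReal_ne_top,
      hY.lintegral_weight_nextPopulation hint h0 h hu, ENNReal.ofReal_mul hρ, mul_left_comm]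

/-- Second-moment control of the normalized weight of the population, relative to its value in
generation `m`. -/
theorem lintegral_sq_weight_ratio_le (hY : IsOffspringFamily μ p Y) (hzero : ∀ j, p j 0 = 0)
    (hC : ∀ i, Integrable (fun y => (size y : ℝ) ^ 2) (p i).toMeasure ∧
      ∫ y, (size y : ℝ) ^ 2 ∂(p i).toMeasure ≤ C) (hC0 : 0 ≤ C) {d : ℝ} (hd : 0 < d)
    (h0 : ∀ k, d ≤ u k) (h : ∀ k, u k ≤ c) (hρ : 1 < ρ)
    (hu : (reproductionMatrix p).mulVec u = ρ • u) (m k : ℕ) :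
    ∫⁻ ω, ENNReal.ofReal (((ρ ^ k * weight u (population Y j₀ m ω))⁻¹ *
        weight u (population Y j₀ (m + k) ω) - 1) ^ 2) ∂μ ≤
      ENNReal.ofReal (c ^ 2 * C / d * ∑ i ∈ Finset.range k, ρ⁻¹ ^ i) *
        ∫⁻ ω, ENNReal.ofReal (weight u (population Y j₀ m ω))⁻¹ ∂μ := by
  have hu0 : ∀ k, 0 ≤ u k := fun k => hd.le.trans (h0 k)
  have hw0 := weight_nonneg hu0
  have hρ0 : 0 < ρ := zero_lt_one.trans hρ
  induction k with
  | zero =>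
    refine (lintegral_eq_zero_of_ae_eq_zero ?_).le.trans zero_le
    filter_upwards [hY.ae_size_population_pos (j₀ := j₀) hzero] with ω hω
    have hpos : 0 < weight u (population Y j₀ m ω) :=
      (mul_pos hd (by exact_mod_cast hω m)).trans_le (le_weight h0 _)
    simp only [pow_zero, one_mul, add_zero, Pi.zero_apply]
    rw [inv_mul_cancel₀ hpos.ne']
    simp
  | succ k ih =>
    set L := ∫⁻ ω, ENNReal.ofReal (weight u (population Y j₀ m ω))⁻¹ ∂μ
    rw [hY.lintegral_population_pair m k fun a b =>
      ENNReal.ofReal (((ρ ^ (k + 1) * weight u a)⁻¹ * weight u b - 1) ^ 2)]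
    -- The bias term reproduces the deviation at `k`, since the mean supplies one factor `ρ`. The
    -- variance factor is weakened from `ρ ^ (-2(k+1))` to `ρ ^ (-2k)`, so that multiplying by the
    -- mean growth `ρ ^ k` gives the next term `ρ⁻¹ ^ k` of the geometric sum.
    have hstep : ∀ ω, ∫⁻ ω', ENNReal.ofReal (((ρ ^ (k + 1) * weight u (population Y j₀ m ω))⁻¹ *
        weight u (nextPopulation (population Y j₀ (m + k) ω) (offspring Y (m + k) ω')) - 1) ^ 2)
          ∂μ ≤
        ENNReal.ofReal (((ρ ^ k * weight u (population Y j₀ m ω))⁻¹ *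
          weight u (population Y j₀ (m + k) ω) - 1) ^ 2) +
        ENNReal.ofReal (c ^ 2 * C / d * (ρ ^ (2 * k))⁻¹) *
          (ENNReal.ofReal ((weight u (population Y j₀ m ω) ^ 2)⁻¹) *
            ENNReal.ofReal (weight u (population Y j₀ (m + k) ω))) := by
      intro ω
      set a := population Y j₀ m ω
      set b := population Y j₀ (m + k) ω
      refine (hY.lintegral_sq_weight_nextPopulation_le hC hu0 h hu (m + k) b _).trans ?_
      rw [← ENNReal.ofReal_mul (by positivity), ← ENNReal.ofReal_mul (by positivity),
        ← ENNReal.ofReal_add (sq_nonneg _)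
          (mul_nonneg (by positivity) (mul_nonneg (by positivity) (hw0 b)))]
      refine ENNReal.ofReal_le_ofReal (add_le_add (le_of_eq ?_) ?_)
      · congr 2
        rw [pow_succ, mul_inv, mul_inv, mul_inv]
        field_simp
      · have hb : (size b : ℝ) ≤ weight u b / d := by
          rw [le_div_iff₀ hd, mul_comm]
          exact le_weight h0 b
        have hρk : ((ρ ^ (k + 1)) ^ 2)⁻¹ ≤ (ρ ^ (2 * k))⁻¹ := by
          rw [← pow_mul]
          exact inv_anti₀ (by positivity) (pow_le_pow_right₀ hρ.le (by omega))
        calc ((ρ ^ (k + 1) * weight u a)⁻¹) ^ 2 * (c ^ 2 * C * size b)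
            = ((ρ ^ (k + 1)) ^ 2)⁻¹ * ((weight u a ^ 2)⁻¹ * (c ^ 2 * C * size b)) := by
              rw [inv_pow, mul_pow, mul_inv, mul_assoc]
          _ ≤ (ρ ^ (2 * k))⁻¹ * ((weight u a ^ 2)⁻¹ * (c ^ 2 * C * (weight u b / d))) := by
              gcongr
          _ = _ := by ring
    calc _ ≤ _ := lintegral_mono hstep
      _ = _ := lintegral_add_left' ?_ _
      _ ≤ ENNReal.ofReal (c ^ 2 * C / d * ∑ i ∈ Finset.range k, ρ⁻¹ ^ i) * L +
          ENNReal.ofReal (c ^ 2 * C / d * (ρ ^ (2 * k))⁻¹) * (ENNReal.ofReal (ρ ^ k) * L) := by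
          rw [lintegral_const_mul' _ _ ENNReal.ofReal_ne_top,
            hY.lintegral_weight_div_sq (fun i => (hC i).1) hu0 h hρ0.le hu]
          gcongr
      _ = _ := by
          rw [← mul_assoc, ← add_mul, ← ENNReal.ofReal_mul (by positivity),
            ← ENNReal.ofReal_add (by positivity) (by positivity)]
          congr 2
          rw [Finset.sum_range_succ, mul_add, mul_assoc (c ^ 2 * C / d) _ (ρ ^ k)]
          congr 2
          rw [two_mul, pow_add, mul_inv, mul_assoc, inv_mul_cancel₀ (by positivity), mul_one,
            inv_pow]
    exact (Measurable.comp (g := fun z : (Fin l → ℕ) × (Fin l → ℕ) =>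
      ENNReal.ofReal (((ρ ^ k * weight u z.1)⁻¹ * weight u z.2 - 1) ^ 2)) Measurable.of_discrete
        ((hY.measurable_population (j₀ := j₀) m).prodMk
          (hY.measurable_population (m + k)))).aemeasurable

theorem lintegral_inv_weight_population_le (hY : IsOffspringFamily μ p Y)
    (hzero : ∀ j, p j 0 = 0)
    {K : ℝ} (hK : ∀ i, Integrable (fun y => (size y : ℝ)⁻¹) (p i).toMeasure ∧
      ∫ y, (size y : ℝ)⁻¹ ∂(p i).toMeasure ≤ K) {d : ℝ} (hd : 0 < d) (h0 : ∀ k, d ≤ u k) (m : ℕ) :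
    ∫⁻ ω, ENNReal.ofReal (weight u (population Y j₀ m ω))⁻¹ ∂μ ≤
      ENNReal.ofReal d⁻¹ * ENNReal.ofReal K ^ m := by
  calc _ ≤ ∫⁻ ω, ENNReal.ofReal d⁻¹ * ENNReal.ofReal (size (population Y j₀ m ω) : ℝ)⁻¹ ∂μ := by
        refine lintegral_mono_ae ?_
        filter_upwards [hY.ae_size_population_pos (j₀ := j₀) hzero] with ω hω
        have hs : (0 : ℝ) < size (population Y j₀ m ω) := by exact_mod_cast hω m
        rw [← ENNReal.ofReal_mul (by positivity), ← mul_inv]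
        exact ENNReal.ofReal_le_ofReal (inv_anti₀ (by positivity) (le_weight h0 _))
    _ ≤ _ := by
        rw [lintegral_const_mul' _ _ ENNReal.ofReal_ne_top]
        gcongr
        exact hY.lintegral_inv_size_population_le hzero hK m

/-- The population is unlikely to grow slower than exponentially with rate `ρ`. -/
theorem exists_measure_size_population_lt_le (hY : IsOffspringFamily μ p Y)
    (hzero : ∀ j, p j 0 = 0)
    (hC : ∀ i, Integrable (fun y => (size y : ℝ) ^ 2) (p i).toMeasure ∧
      ∫ y, (size y : ℝ) ^ 2 ∂(p i).toMeasure ≤ C)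
    {K : ℝ} (hK : ∀ i, Integrable (fun y => (size y : ℝ)⁻¹) (p i).toMeasure ∧
      ∫ y, (size y : ℝ)⁻¹ ∂(p i).toMeasure ≤ K)
    (hu0 : ∀ k, 0 < u k) (hρ : 1 < ρ) (hu : (reproductionMatrix p).mulVec u = ρ • u)
    (j₀ : Fin l) :
    ∃ δ : ℝ, 0 < δ ∧ ∃ B : ℝ≥0∞, B ≠ ⊤ ∧ ∀ m k : ℕ,
      μ {ω | (size (population Y j₀ (m + k) ω) : ℝ) < δ * ρ ^ k} ≤ B * ENNReal.ofReal K ^ m := by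
  have : Nonempty (Fin l) := ⟨j₀⟩
  obtain ⟨i₁, hmin⟩ := Finite.exists_min u
  obtain ⟨i₂, hmax⟩ := Finite.exists_max u
  have hd : 0 < u i₁ := hu0 i₁
  have hc : 0 < u i₂ := hu0 i₂
  generalize u i₁ = d at hd hmin
  generalize u i₂ = c at hc hmax
  have hC0 : 0 ≤ C := (integral_nonneg fun y => sq_nonneg (size y : ℝ)).trans (hC j₀).2
  -- In `B`, the geometric series bounds all variance increments, `d⁻¹` compares inverse weight with
  -- inverse size, and `1 / 4` comes from Markov's inequality.
  refine ⟨d / (2 * c), by positivity, ENNReal.ofReal (c ^ 2 * C / d * (1 - ρ⁻¹)⁻¹) *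
    ENNReal.ofReal d⁻¹ / ENNReal.ofReal (1 / 4), ?_, fun m k => ?_⟩
  · exact ENNReal.div_ne_top (ENNReal.mul_ne_top ENNReal.ofReal_ne_top ENNReal.ofReal_ne_top)
      (ENNReal.ofReal_pos.2 (by norm_num)).ne'
  have hsum : ∑ i ∈ Finset.range k, ρ⁻¹ ^ i ≤ (1 - ρ⁻¹)⁻¹ := by
    have h1 : ρ⁻¹ < 1 := inv_lt_one_of_one_lt₀ hρ
    rw [← tsum_geometric_of_lt_one (by positivity) h1]
    exact (summable_geometric_of_lt_one (by positivity) h1).sum_le_tsum _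
      fun i _ => by positivity
  refine (hY.measure_size_population_lt_le_lintegral hzero hd hmin hmax hc
    (zero_lt_one.trans hρ) m k).trans ?_
  rw [← ENNReal.mul_div_right_comm, mul_assoc]
  refine ENNReal.div_le_div_right ?_ _
  refine (hY.lintegral_sq_weight_ratio_le hzero hC hC0 hd hmin hmax hρ hu m k).trans ?_
  refine mul_le_mul' (ENNReal.ofReal_le_ofReal ?_)
    (hY.lintegral_inv_weight_population_le hzero hK hd hmin m)
  exact mul_le_mul_of_nonneg_left hsum (by positivity)

end IsOffspringFamily

end GaltonWatson

/-! ### From the sibling probability to the size of the parent generation. -/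

namespace GaltonWatson

variable {l : ℕ}

/-- The individuals of the next generation, given the current population vector and the offspring
vectors. -/
def nextGeneration (b : Fin l → ℕ) (v : Fin l × ℕ → Fin l → ℕ) : Finset (Individual l) :=
  (labels b).biUnion fun x => (labels (v x)).image (Prod.mk x)

theorem mem_nextGeneration {b : Fin l → ℕ} {v : Fin l × ℕ → Fin l → ℕ} {z : Individual l} :
    z ∈ nextGeneration b v ↔ z.1 ∈ labels b ∧ z.2 ∈ labels (v z.1) := by
  obtain ⟨x, y⟩ := z
  simp only [nextGeneration, Finset.mem_biUnion, Finset.mem_image, Prod.mk.injEq]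
  constructor
  · rintro ⟨x', hx', y', hy', rfl, rfl⟩
    exact ⟨hx', hy'⟩
  · rintro ⟨hx, hy⟩
    exact ⟨x, hx, y, hy, rfl, rfl⟩

theorem card_nextGeneration (b : Fin l → ℕ) (v : Fin l × ℕ → Fin l → ℕ) :
    (nextGeneration b v).card = size (nextPopulation b v) := by
  rw [nextGeneration, Finset.card_biUnion, size_nextPopulation]
  · refine Finset.sum_congr rfl fun x _ => ?_
    rw [Finset.card_image_of_injective _ (Prod.mk_right_injective x), card_labels]
  · intro x _ x' _ hx
    refine Finset.disjoint_left.2 fun z hz hz' => hx ?_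
    obtain ⟨y, -, rfl⟩ := Finset.mem_image.1 hz
    obtain ⟨y', -, h⟩ := Finset.mem_image.1 hz'
    exact (Prod.mk.inj h).1.symm

theorem card_siblingPairs_nextGeneration_le (b : Fin l → ℕ) (v : Fin l × ℕ → Fin l → ℕ) :
    (siblingPairs (nextGeneration b v)).card ≤ ∑ x ∈ labels b, size (v x) ^ 2 := by
  have hsub : siblingPairs (nextGeneration b v) ⊆ (labels b).biUnion fun x =>
      (labels (v x) ×ˢ labels (v x)).image fun y => ((x, y.1), (x, y.2)) := by
    rintro ⟨⟨x, y⟩, ⟨x', y'⟩⟩ h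
    obtain ⟨h, hp⟩ := Finset.mem_filter.1 h
    obtain ⟨hxy, hxy', -⟩ := Finset.mem_offDiag.1 h
    obtain ⟨hx, hy⟩ := mem_nextGeneration.1 hxy
    obtain ⟨-, hy'⟩ := mem_nextGeneration.1 hxy'
    obtain rfl : x = x' := hp
    exact Finset.mem_biUnion.2 ⟨x, hx, Finset.mem_image.2
      ⟨(y, y'), Finset.mem_product.2 ⟨hy, hy'⟩, rfl⟩⟩
  refine (Finset.card_le_card hsub).trans (Finset.card_biUnion_le.trans
    (Finset.sum_le_sum fun x _ => Finset.card_image_le.trans ?_))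
  rw [Finset.card_product, card_labels, sq]

/-- For `T ≥ 2` one has `T (T - 1) ≥ T² / 2`, and `T` is at least the size of `b`; this explains the
factor 2. For `T = 1` the quotient is 0 by division by zero. -/
theorem siblingBound_nextGeneration_le {b : Fin l → ℕ} {v : Fin l × ℕ → Fin l → ℕ}
    (hv : ∀ x, 0 < size (v x)) (hb : 0 < size b) (r : ℕ) :
    siblingBound r (nextGeneration b v) ≤
      min 1 (2 * (r : ℝ) ^ 2 / (size b : ℝ) ^ 2 * ∑ x ∈ labels b, (size (v x) : ℝ) ^ 2) := by
  refine min_le_min_left 1 ?_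
  have hN : (1 : ℝ) ≤ size b := by exact_mod_cast hb
  have hNT : (size b : ℝ) ≤ (nextGeneration b v).card := by
    rw [card_nextGeneration]
    exact_mod_cast size_le_size_nextPopulation hv
  have hS : ((siblingPairs (nextGeneration b v)).card : ℝ) ≤
      ∑ x ∈ labels b, (size (v x) : ℝ) ^ 2 := by
    exact_mod_cast card_siblingPairs_nextGeneration_le b v
  have hS0 : (0 : ℝ) ≤ ∑ x ∈ labels b, (size (v x) : ℝ) ^ 2 :=
    Finset.sum_nonneg fun _ _ => sq_nonneg _
  set T := (nextGeneration b v).card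
  rcases le_or_gt T 1 with hT | hT
  · have : (T : ℝ) = 1 := le_antisymm (by exact_mod_cast hT) (hN.trans hNT)
    rw [this]
    simp only [sub_self, mul_zero, div_zero]
    positivity
  · have hT2 : (2 : ℝ) ≤ T := by exact_mod_cast hT
    calc (r : ℝ) ^ 2 * ((siblingPairs (nextGeneration b v)).card / (T * (T - 1)))
        ≤ (r : ℝ) ^ 2 * ((∑ x ∈ labels b, (size (v x) : ℝ) ^ 2) / ((size b : ℝ) ^ 2 / 2)) := by
          gcongr
          nlinarith
      _ = _ := by field_simp

theorem generation_succ {Ω : Type*} (Y : ℕ → Fin l → ℕ → Ω → (Fin l → ℕ)) (j₀ : Fin l) (n : ℕ) :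
    generation Y j₀ (n + 1) =
      fun ω => ↑(nextGeneration (population Y j₀ n ω) (offspring Y n ω)) := by
  funext ω
  ext z
  simp only [generation, Finset.mem_coe, mem_nextGeneration, mem_labels, Nat.add_sub_cancel]
  rfl

theorem measurableSet_nextGeneration_eq (g : Finset (Individual l)) :
    MeasurableSet {z : (Fin l → ℕ) × (Fin l × ℕ → Fin l → ℕ) | nextGeneration z.1 z.2 = g} := by
  have : {z : (Fin l → ℕ) × (Fin l × ℕ → Fin l → ℕ) | nextGeneration z.1 z.2 = g} =
      ⋂ x : Individual l, {z | (x.1.2 < z.1 x.1.1 ∧ x.2.2 < z.2 x.1 x.2.1) ↔ x ∈ g} := by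
    ext z
    simp [Finset.ext_iff, mem_nextGeneration]
  rw [this]
  refine MeasurableSet.iInter fun x => ?_
  refine Measurable.comp (g := fun n : ℕ × ℕ => (x.1.2 < n.1 ∧ x.2.2 < n.2) ↔ x ∈ g)
    (f := fun z : (Fin l → ℕ) × (Fin l × ℕ → Fin l → ℕ) => (z.1 x.1.1, z.2 x.1 x.2.1))
    Measurable.of_discrete (by fun_prop) |>.setOf

theorem eq_single_of_size_eq_one {y : Fin l → ℕ} (h : size y = 1) : ∃ k, y = Pi.single k 1 := by
  obtain ⟨k, hk⟩ : ∃ k, y k ≠ 0 := by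
    by_contra! h0
    simp [size, h0] at h
  refine ⟨k, funext fun i => ?_⟩
  have hsum : y k + ∑ i ∈ Finset.univ.erase k, y i = 1 := by
    rw [Finset.add_sum_erase _ _ (Finset.mem_univ k)]
    exact h
  rcases eq_or_ne i k with rfl | hi
  · rw [Pi.single_eq_same]
    omega
  · rw [Pi.single_eq_of_ne hi]
    have := Finset.single_le_sum (f := y) (fun _ _ => Nat.zero_le _)
      (Finset.mem_erase.2 ⟨hi, Finset.mem_univ i⟩)
    omega

/-- The nonnegative function `1 - 1 / |y|` vanishes only at unit vectors, which do not carry full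
mass. At `y = 0` it equals 1 by `0⁻¹ = 0`, so the zero vector needs no exclusion. -/
theorem integral_inv_size_lt_one {q : PMF (Fin l → ℕ)} (hq : ∑ k, q (Pi.single k 1) < 1)
    (hint : Integrable (fun y => (size y : ℝ)⁻¹) q.toMeasure) :
    ∫ y, (size y : ℝ)⁻¹ ∂q.toMeasure < 1 := by
  have hnonneg : ∀ y : Fin l → ℕ, 0 ≤ 1 - (size y : ℝ)⁻¹ := fun y => by
    rcases Nat.eq_zero_or_pos (size y) with h | h
    · simp [h]
    · exact sub_nonneg.2 (inv_le_one_of_one_le₀ (by exact_mod_cast h))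
  have hpos : 0 < ∫ y, (1 - (size y : ℝ)⁻¹) ∂q.toMeasure := by
    rw [integral_pos_iff_support_of_nonneg hnonneg ((integrable_const 1).sub hint)]
    refine pos_iff_ne_zero.2 fun h0 => hq.not_ge ?_
    have hcover : (Set.univ : Set (Fin l → ℕ)) ⊆
        Function.support (fun y : Fin l → ℕ => 1 - (size y : ℝ)⁻¹) ∪
          ⋃ k ∈ (Finset.univ : Finset (Fin l)), {Pi.single k 1} := by
      intro y _
      by_cases h : size y = 1
      · right
        obtain ⟨k, hk⟩ := eq_single_of_size_eq_one h
        simpa using ⟨k, hk.symm⟩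
      · left
        rw [Function.mem_support, sub_ne_zero]
        exact fun h' => h (by exact_mod_cast (inv_eq_one.1 h'.symm))
    calc (1 : ℝ≥0∞) = q.toMeasure Set.univ := measure_univ.symm
      _ ≤ _ := measure_mono hcover
      _ ≤ _ := measure_union_le _ _
      _ ≤ 0 + ∑ k, q.toMeasure {Pi.single k 1} :=
          add_le_add h0.le (measure_biUnion_finset_le _ _)
      _ = ∑ k, q (Pi.single k 1) := by
          rw [zero_add]
          exact Finset.sum_congr rfl fun k _ =>
            PMF.toMeasure_apply_singleton _ _ (MeasurableSet.singleton _)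
  rw [integral_sub (integrable_const 1) hint] at hpos
  simpa using hpos

theorem exists_integral_inv_size_le {p : Fin l → PMF (Fin l → ℕ)} [Nonempty (Fin l)]
    (hone : ∀ j, ∑ k, p j (Pi.single k 1) < 1)
    (hint : ∀ i, Integrable (fun y => (size y : ℝ)⁻¹) (p i).toMeasure) :
    ∃ K < 1, ∀ i, Integrable (fun y => (size y : ℝ)⁻¹) (p i).toMeasure ∧
      ∫ y, (size y : ℝ)⁻¹ ∂(p i).toMeasure ≤ K := by
  obtain ⟨i₀, h⟩ := Finite.exists_max fun i => ∫ y, (size y : ℝ)⁻¹ ∂(p i).toMeasure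
  exact ⟨_, integral_inv_size_lt_one (hone i₀) (hint i₀), fun i => ⟨hint i, h i⟩⟩

namespace IsOffspringFamily

variable {Ω : Type*} {Y : ℕ → Fin l → ℕ → Ω → (Fin l → ℕ)} {j₀ : Fin l} [MeasurableSpace Ω]
  {μ : Measure Ω} {p : Fin l → PMF (Fin l → ℕ)} [IsProbabilityMeasure μ] {C : ℝ}

theorem lintegral_min_sum_sq_size_le (hY : IsOffspringFamily μ p Y)
    (hC : ∀ i, Integrable (fun y => (size y : ℝ) ^ 2) (p i).toMeasure ∧
      ∫ y, (size y : ℝ) ^ 2 ∂(p i).toMeasure ≤ C) {a : ℝ} (ha : 0 ≤ a) (n : ℕ) (b : Fin l → ℕ) :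
    ∫⁻ ω, ENNReal.ofReal (min 1
        (a / (size b : ℝ) ^ 2 * ∑ x ∈ labels b, (size (offspring Y n ω x) : ℝ) ^ 2)) ∂μ ≤
      ENNReal.ofReal (min 1 (a * C / size b)) := by
  have hint : Integrable (fun ω => a / (size b : ℝ) ^ 2 *
      ∑ x ∈ labels b, (size (offspring Y n ω x) : ℝ) ^ 2) μ :=
    (integrable_finsetSum _ fun x _ => hY.integrable_offspring n x (hC x.1).1).const_mul _
  rw [ENNReal.ofReal_min, ENNReal.ofReal_one]
  refine le_min ?_ ?_
  · calc _ ≤ ∫⁻ _, (1 : ℝ≥0∞) ∂μ :=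
          lintegral_mono fun ω => (ENNReal.ofReal_le_ofReal (min_le_left _ _)).trans_eq
            ENNReal.ofReal_one
      _ = 1 := by simp
  · calc _ ≤ ∫⁻ ω, ENNReal.ofReal (a / (size b : ℝ) ^ 2 *
            ∑ x ∈ labels b, (size (offspring Y n ω x) : ℝ) ^ 2) ∂μ :=
          lintegral_mono fun ω => ENNReal.ofReal_le_ofReal (min_le_right _ _)
      _ = ENNReal.ofReal (∫ ω, a / (size b : ℝ) ^ 2 *
            ∑ x ∈ labels b, (size (offspring Y n ω x) : ℝ) ^ 2 ∂μ) :=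
          (ofReal_integral_eq_lintegral_ofReal hint
            (ae_of_all _ fun ω => by positivity)).symm
      _ ≤ _ := by
          refine ENNReal.ofReal_le_ofReal ?_
          rw [integral_const_mul, integral_finsetSum _ fun x _ =>
            hY.integrable_offspring n x (hC x.1).1]
          simp only [hY.integral_offspring n _ fun y => (size y : ℝ) ^ 2]
          calc _ ≤ a / (size b : ℝ) ^ 2 * ∑ x ∈ labels b, C := by
                gcongr with x _
                exact (hC x.1).2
            _ = _ := by
                rw [Finset.sum_const, card_labels, nsmul_eq_mul]
                rcases eq_or_ne (size b : ℝ) 0 with h | h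
                · simp [h]
                · field_simp

/-- The probability that the sample does not exist or has siblings, in terms of the size of the
parent generation. -/
theorem measure_nonSibling_compl_le (hY : IsOffspringFamily μ p Y) (hzero : ∀ j, p j 0 = 0)
    (hC : ∀ i, Integrable (fun y => (size y : ℝ) ^ 2) (p i).toMeasure ∧
      ∫ y, (size y : ℝ) ^ 2 ∂(p i).toMeasure ≤ C) (hC1 : 1 ≤ C) (n : ℕ) {r : ℕ}
    {X : Ω → Fin r → Individual l}
    (hX : IsSampleWithoutReplacement μ (generation Y j₀ (n + 1)) r X) :
    μ (nonSibling (generation Y j₀ (n + 1)) X)ᶜ ≤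
      2 * ∫⁻ ω, ENNReal.ofReal
        (min 1 (2 * (r : ℝ) ^ 2 * C / size (population Y j₀ n ω))) ∂μ := by
  rw [generation_succ] at hX ⊢
  set G : Ω → Finset (Individual l) :=
    fun ω => nextGeneration (population Y j₀ n ω) (offspring Y n ω)
  have hG : ∀ g, MeasurableSet {ω | G ω = g} := fun g =>
    ((hY.measurable_population (j₀ := j₀) n).prodMk (hY.measurable_offspring n))
      (measurableSet_nextGeneration_eq g)
  -- Generations never shrink, so a missing sample forces the parent generation to have at most `r`
  -- members. With `1 ≤ C` the truncated integrand is then 1, and Markov's inequality applies.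
  have h1 : μ {ω | (G ω).card < r} ≤ ∫⁻ ω, ENNReal.ofReal
      (min 1 (2 * (r : ℝ) ^ 2 * C / size (population Y j₀ n ω))) ∂μ := by
    have hm : AEMeasurable (fun ω => ENNReal.ofReal
        (min 1 (2 * (r : ℝ) ^ 2 * C / size (population Y j₀ n ω)))) μ :=
      (Measurable.comp (g := fun y : Fin l → ℕ => ENNReal.ofReal
        (min 1 (2 * (r : ℝ) ^ 2 * C / size y))) Measurable.of_discrete
          (hY.measurable_population (j₀ := j₀) n)).aemeasurable
    refine (measure_mono_ae ?_).trans
      ((meas_ge_le_lintegral_div hm one_ne_zero ENNReal.one_ne_top).trans_eq (div_one _))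
    filter_upwards [hY.ae_size_population_pos (j₀ := j₀) hzero, hY.ae_size_offspring_pos hzero n]
      with ω hω hω' hlt
    have hlt : (G ω).card < r := hlt
    have hN : (size (population Y j₀ n ω) : ℝ) ≤ r := by
      have := (size_le_size_nextPopulation (b := population Y j₀ n ω) hω').trans_lt
        (card_nextGeneration _ _ ▸ hlt)
      exact_mod_cast this.le
    have hN0 : (0 : ℝ) < size (population Y j₀ n ω) := by exact_mod_cast hω n
    have hr1 : (1 : ℝ) ≤ r := by exact_mod_cast (Nat.zero_le _).trans_lt hlt
    refine ENNReal.one_le_ofReal.2 (le_min le_rfl ?_)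
    rw [one_le_div hN0]
    calc _ ≤ (r : ℝ) := hN
      _ ≤ r ^ 2 := le_self_pow₀ hr1 two_ne_zero
      _ ≤ 2 * r ^ 2 * C := by nlinarith [sq_nonneg (r : ℝ)]
  have h2 : ∫⁻ ω, ENNReal.ofReal (siblingBound r (G ω)) ∂μ ≤ ∫⁻ ω, ENNReal.ofReal
      (min 1 (2 * (r : ℝ) ^ 2 * C / size (population Y j₀ n ω))) ∂μ := by
    calc _ ≤ ∫⁻ ω, ENNReal.ofReal (min 1 (2 * (r : ℝ) ^ 2 /
          (size (population Y j₀ n ω) : ℝ) ^ 2 * ∑ x ∈ labels (population Y j₀ n ω),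
            (size (offspring Y n ω x) : ℝ) ^ 2)) ∂μ := by
          refine lintegral_mono_ae ?_
          filter_upwards [hY.ae_size_population_pos (j₀ := j₀) hzero,
            hY.ae_size_offspring_pos hzero n] with ω hω hω'
          exact ENNReal.ofReal_le_ofReal (siblingBound_nextGeneration_le hω' (hω n) r)
      _ = _ := hY.lintegral_population_offspring (H := population Y j₀ n)
          (g := fun b v => ENNReal.ofReal (min 1 (2 * (r : ℝ) ^ 2 / (size b : ℝ) ^ 2 *
            ∑ x ∈ labels b, (size (v x) : ℝ) ^ 2))) (measurable_population_history n) ?_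
      _ ≤ _ := lintegral_mono fun ω => hY.lintegral_min_sum_sq_size_le hC (by positivity) n _
    refine measurable_from_prod_countable_right fun b => ?_
    have hsum : Measurable fun v : Fin l × ℕ → Fin l → ℕ =>
        ∑ x ∈ labels b, (size (v x) : ℝ) ^ 2 :=
      Finset.measurable_fun_sum _ fun x _ => Measurable.comp
        (g := fun y : Fin l → ℕ => (size y : ℝ) ^ 2) Measurable.of_discrete (measurable_pi_apply x)
    exact ENNReal.measurable_ofReal.comp (measurable_const.min
      (hsum.const_mul (2 * (r : ℝ) ^ 2 / (size b : ℝ) ^ 2)))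
  calc _ ≤ μ ({ω | (G ω).card < r} ∪
        ({ω | r ≤ (G ω).card} ∩ (nonSibling (fun ω => ↑(G ω)) X)ᶜ)) := by
        refine measure_mono fun ω hω => ?_
        rcases lt_or_ge (G ω).card r with h | h
        · exact Or.inl h
        · exact Or.inr ⟨h, hω⟩
    _ ≤ _ := measure_union_le _ _
    _ ≤ _ := add_le_add h1 ((measure_inter_nonSibling_compl_le hG hX).trans h2)
    _ = _ := (two_mul _).symm

theorem lintegral_min_div_size_le (hY : IsOffspringFamily μ p Y) (hzero : ∀ j, p j 0 = 0)
    {K : ℝ} (hK : ∀ i, Integrable (fun y => (size y : ℝ)⁻¹) (p i).toMeasure ∧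
      ∫ y, (size y : ℝ)⁻¹ ∂(p i).toMeasure ≤ K) {a : ℝ} (ha : 0 ≤ a) (n : ℕ) :
    ∫⁻ ω, ENNReal.ofReal (min 1 (a / size (population Y j₀ n ω))) ∂μ ≤
      ENNReal.ofReal a * ENNReal.ofReal K ^ n := by
  calc _ ≤ ∫⁻ ω, ENNReal.ofReal a * ENNReal.ofReal (size (population Y j₀ n ω) : ℝ)⁻¹ ∂μ := by
        refine lintegral_mono fun ω => ?_
        rw [← ENNReal.ofReal_mul ha, ← div_eq_mul_inv]
        exact ENNReal.ofReal_le_ofReal (min_le_right _ _)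
    _ ≤ _ := by
        rw [lintegral_const_mul' _ _ ENNReal.ofReal_ne_top]
        gcongr
        exact hY.lintegral_inv_size_population_le hzero hK n

/-- Split at size `s`: the truncation is used below it and the quotient above it. -/
theorem lintegral_min_div_size_le_add (hY : IsOffspringFamily μ p Y) {a s : ℝ} (ha : 0 ≤ a)
    (hs : 0 < s) (n : ℕ) :
    ∫⁻ ω, ENNReal.ofReal (min 1 (a / size (population Y j₀ n ω))) ∂μ ≤
      μ {ω | (size (population Y j₀ n ω) : ℝ) < s} + ENNReal.ofReal (a / s) := by
  have hm : MeasurableSet {ω | (size (population Y j₀ n ω) : ℝ) < s} :=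
    hY.measurable_population n (MeasurableSet.of_discrete (s := {y | (size y : ℝ) < s}))
  calc _ ≤ ∫⁻ ω, ({ω | (size (population Y j₀ n ω) : ℝ) < s}.indicator 1 ω +
        ENNReal.ofReal (a / s)) ∂μ := by
        refine lintegral_mono fun ω => ?_
        by_cases h : (size (population Y j₀ n ω) : ℝ) < s
        · rw [Set.indicator_of_mem (show ω ∈ {ω | (size (population Y j₀ n ω) : ℝ) < s} from h)]
          refine le_add_right ?_
          exact (ENNReal.ofReal_le_ofReal (min_le_left _ _)).trans_eq ENNReal.ofReal_one
        · refine le_add_left (ENNReal.ofReal_le_ofReal ((min_le_right _ _).trans ?_))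
          exact div_le_div_of_nonneg_left ha hs (not_lt.1 h)
    _ = _ := by
        rw [lintegral_add_right _ measurable_const, lintegral_indicator_one hm]
        simp

/-- If `a n = o(ρ ^ n)`, then the truncated mean of `a n / |Z_n|` vanishes. -/
theorem tendsto_lintegral_min_div_size (hY : IsOffspringFamily μ p Y) (hzero : ∀ j, p j 0 = 0)
    (hone : ∀ j, ∑ k, p j (Pi.single k 1) < 1)
    (hC : ∀ i, Integrable (fun y => (size y : ℝ) ^ 2) (p i).toMeasure ∧
      ∫ y, (size y : ℝ) ^ 2 ∂(p i).toMeasure ≤ C)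
    (hint : ∀ i, Integrable (fun y => (size y : ℝ)⁻¹) (p i).toMeasure)
    (hreg : PositivelyRegular (reproductionMatrix p)) {ρ : ℝ}
    (hρ : IsLargestEigenvalue (reproductionMatrix p) ρ) (hρ1 : 1 < ρ) {a : ℕ → ℝ}
    (ha0 : ∀ n, 0 ≤ a n) (ha : Tendsto (fun n => a n / ρ ^ n) atTop (𝓝 0)) :
    Tendsto (fun n => ∫⁻ ω, ENNReal.ofReal (min 1 (a n / size (population Y j₀ n ω))) ∂μ)
      atTop (𝓝 0) := by
  have : Nonempty (Fin l) := ⟨j₀⟩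
  have hρ0 : 0 < ρ := zero_lt_one.trans hρ1
  obtain ⟨u, hu0, hu⟩ := hρ.exists_pos_eigenvector (reproductionMatrix_nonneg p) hreg hρ0
  -- This `K` is the largest of the actual inverse means, which is below 1; a prescribed upper bound
  -- need not be.
  obtain ⟨K, hK1, hK⟩ := exists_integral_inv_size_le hone hint
  obtain ⟨δ, hδ, B, hB, htail⟩ :=
    hY.exists_measure_size_population_lt_le hzero hC hK hu0 hρ1 hu j₀
  have hBK : Tendsto (fun m => B * ENNReal.ofReal K ^ m) atTop (𝓝 0) := by
    have h := ENNReal.Tendsto.const_mul (a := B)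
      (ENNReal.tendsto_pow_atTop_nhds_zero_of_lt_one (ENNReal.ofReal_lt_one.2 hK1)) (Or.inr hB)
    rwa [mul_zero] at h
  rw [ENNReal.tendsto_nhds_zero]
  intro ε hε
  have hε2 : 0 < ε / 2 := ENNReal.half_pos hε.ne'
  -- The restart generation is fixed before `n` grows; it costs only the constant factor `ρ ^ m /
  -- δ`.
  obtain ⟨m, hm⟩ := (ENNReal.tendsto_nhds_zero.1 hBK _ hε2).exists
  have hlim : Tendsto (fun n => ENNReal.ofReal (ρ ^ m / δ * (a n / ρ ^ n))) atTop (𝓝 0) := by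
    have h := ENNReal.tendsto_ofReal (ha.const_mul (ρ ^ m / δ))
    rwa [mul_zero, ENNReal.ofReal_zero] at h
  filter_upwards [ENNReal.tendsto_nhds_zero.1 hlim _ hε2, eventually_ge_atTop m] with n hn hmn
  obtain ⟨k, rfl⟩ := Nat.exists_eq_add_of_le hmn
  calc _ ≤ _ := hY.lintegral_min_div_size_le_add (ha0 _) (by positivity : 0 < δ * ρ ^ k) (m + k)
    _ ≤ ε / 2 + ε / 2 := by
        refine add_le_add ((htail m k).trans hm) (le_of_eq_of_le ?_ hn)
        congr 1
        rw [pow_add]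
        field_simp
    _ = ε := ENNReal.add_halves ε

end IsOffspringFamily

/-- Subadditivity suffices, so `s` need not be measurable. -/
theorem one_sub_measureReal_le {Ω : Type*} [MeasurableSpace Ω] (μ : Measure Ω)
    [IsProbabilityMeasure μ] (s : Set Ω) : 1 - μ.real s ≤ μ.real sᶜ := by
  have h := measureReal_union_le (μ := μ) s sᶜ
  rw [Set.union_compl_self, probReal_univ] at h
  linarith

end GaltonWatson

/-! ### The two limits. -/

theorem theorem3p1 {Ω : Type*} [MeasurableSpace Ω] (μ : Measure Ω) [IsProbabilityMeasure μ]
    (l : ℕ) (hl : 2 ≤ l)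
    -- offspring laws, offspring vectors, type of the founder
    (p : Fin l → PMF (Fin l → ℕ)) (Y : ℕ → Fin l → ℕ → Ω → (Fin l → ℕ))
    (hY : GaltonWatson.IsOffspringFamily μ p Y) (j₀ : Fin l)
    -- no zero offspring, and not almost surely exactly one child
    (hzero : ∀ j, p j 0 = 0)
    (hone : ∀ j, ∑ k, p j (Pi.single k 1) < 1)
    -- positive regularity, largest eigenvalue larger than one
    (hreg : GaltonWatson.PositivelyRegular (GaltonWatson.reproductionMatrix p))
    (ρ : ℝ) (hρ : GaltonWatson.IsLargestEigenvalue (GaltonWatson.reproductionMatrix p) ρ)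
    (hρ1 : 1 < ρ)
    -- sample sizes
    (r : ℕ → ℕ) (hr1 : ∀ n, 1 ≤ r n)
    (hr : Tendsto (fun n : ℕ => (r n : ℝ) ^ 2 * ρ ^ (-(n : ℝ))) atTop (𝓝 0))
    -- moment bounds
    (C : ℝ)
    (hC : ∀ i, Integrable (fun y => (GaltonWatson.size y : ℝ) ^ 2) (p i).toMeasure ∧
      ∫ y, (GaltonWatson.size y : ℝ) ^ 2 ∂(p i).toMeasure ≤ C)
    (K : ℝ)
    (hK : ∀ i, Integrable (fun y => (GaltonWatson.size y : ℝ)⁻¹) (p i).toMeasure ∧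
      ∫ y, (GaltonWatson.size y : ℝ)⁻¹ ∂(p i).toMeasure ≤ K)
    -- the samples of generations `n ≥ 1`
    (X : (n : ℕ) → Ω → Fin (r n) → GaltonWatson.Individual l)
    (hX : ∀ n, 1 ≤ n →
      GaltonWatson.IsSampleWithoutReplacement μ (GaltonWatson.generation Y j₀ n) (r n) (X n)) :
    Tendsto (fun n => μ.real (GaltonWatson.nonSibling (GaltonWatson.generation Y j₀ n) (X n)))
        atTop (𝓝 1) ∧
      ∀ α ∈ Set.Ioo 0 (-Real.logb ρ K),
        Tendsto (fun n : ℕ => ρ ^ (α * n) * ((r n : ℝ) ^ 2)⁻¹ *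
            (1 - μ.real (GaltonWatson.nonSibling (GaltonWatson.generation Y j₀ n) (X n))))
          atTop (𝓝 0) := by
  have : Nonempty (Fin l) := ⟨j₀⟩
  have hρ0 : 0 < ρ := zero_lt_one.trans hρ1
  set A : ℕ → Set Ω := fun n => GaltonWatson.nonSibling (GaltonWatson.generation Y j₀ n) (X n)
  -- Raising the second-moment bound to at least 1 lets one estimate cover missing samples as well.
  have hC' : ∀ i, Integrable (fun y => (GaltonWatson.size y : ℝ) ^ 2) (p i).toMeasure ∧
      ∫ y, (GaltonWatson.size y : ℝ) ^ 2 ∂(p i).toMeasure ≤ max C 1 :=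
    fun i => ⟨(hC i).1, (hC i).2.trans (le_max_left _ _)⟩
  have hC1 : 1 ≤ max C 1 := le_max_right _ _
  generalize max C 1 = D at hC' hC1
  have hbound : ∀ n, μ (A (n + 1))ᶜ ≤ 2 * ∫⁻ ω, ENNReal.ofReal (min 1
      (2 * (r (n + 1) : ℝ) ^ 2 * D / GaltonWatson.size (GaltonWatson.population Y j₀ n ω))) ∂μ :=
    fun n =>
    hY.measure_nonSibling_compl_le hzero hC' hC1 n (hX (n + 1) n.succ_pos)
  have hnonneg : ∀ n, 0 ≤ 1 - μ.real (A n) := fun n => sub_nonneg.2 measureReal_le_one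
  constructor
  · have ha : Tendsto (fun n => 2 * (r (n + 1) : ℝ) ^ 2 * D / ρ ^ n) atTop (𝓝 0) := by
      have h := ((tendsto_add_atTop_iff_nat 1).2 hr).const_mul (2 * D * ρ)
      rw [mul_zero] at h
      refine h.congr fun n => ?_
      rw [Real.rpow_neg hρ0.le, Real.rpow_natCast, pow_succ]
      field_simp
      ring
    have h0 := hY.tendsto_lintegral_min_div_size (j₀ := j₀) hzero hone hC' (fun i => (hK i).1)
      hreg hρ hρ1 (fun n => by positivity) ha
    have h1 : Tendsto (fun n => μ (A (n + 1))ᶜ) atTop (𝓝 0) := by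
      have h2 := ENNReal.Tendsto.const_mul (a := 2) h0 (Or.inr ENNReal.ofNat_ne_top)
      rw [mul_zero] at h2
      exact tendsto_of_tendsto_of_tendsto_of_le_of_le tendsto_const_nhds h2
        (fun _ => zero_le) hbound
    have h2 : Tendsto (fun n => μ.real (A (n + 1))ᶜ) atTop (𝓝 0) := by
      exact (ENNReal.tendsto_toReal ENNReal.zero_ne_top).comp h1
    rw [← tendsto_add_atTop_iff_nat 1]
    have h3 := squeeze_zero (fun n => hnonneg (n + 1))
      (fun n => GaltonWatson.one_sub_measureReal_le μ _) h2
    simpa using h3.const_sub 1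
  · rintro α ⟨-, hα⟩
    have hK0 : 0 ≤ K := (integral_nonneg fun y => by positivity).trans (hK j₀).2
    have hαK : ρ ^ α * K < 1 := by
      -- `K = 0` is treated apart, since `Real.logb` does not represent a logarithm there.
      rcases hK0.eq_or_lt with h | h
      · simp [← h]
      · have h1 := (Real.logb_lt_iff_lt_rpow hρ1 h).1 (lt_neg.1 hα)
        rw [Real.rpow_neg hρ0.le] at h1
        have h2 : 0 < ρ ^ α := Real.rpow_pos_of_pos hρ0 α
        have h3 := mul_lt_mul_of_pos_left h1 h2
        rwa [mul_inv_cancel₀ h2.ne'] at h3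
    rw [← tendsto_add_atTop_iff_nat 1]
    -- The factor `r ^ 2` cancels exactly; the extra `ρ ^ α` is the shift from `n` to `n + 1`, and 4
    -- is the product of the two factors 2.
    have hlim : Tendsto (fun n : ℕ => 4 * D * ρ ^ α * (ρ ^ α * K) ^ n) atTop (𝓝 0) := by
      have h := (tendsto_pow_atTop_nhds_zero_of_lt_one (by positivity) hαK).const_mul
        (4 * D * ρ ^ α)
      rwa [mul_zero] at h
    refine squeeze_zero (fun n => mul_nonneg (by positivity) (hnonneg (n + 1))) (fun n => ?_) hlim
    have hr0 : (0 : ℝ) < r (n + 1) := by exact_mod_cast hr1 (n + 1)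
    have hA : 1 - μ.real (A (n + 1)) ≤ 2 * (2 * (r (n + 1) : ℝ) ^ 2 * D * K ^ n) := by
      refine (GaltonWatson.one_sub_measureReal_le μ _).trans
        (ENNReal.toReal_le_of_le_ofReal (by positivity) ?_)
      refine (hbound n).trans ?_
      rw [ENNReal.ofReal_mul zero_le_two, ENNReal.ofReal_ofNat, ENNReal.ofReal_mul (by positivity),
        ENNReal.ofReal_pow hK0]
      exact mul_le_mul_right (hY.lintegral_min_div_size_le hzero hK (by positivity) n) 2
    calc _ ≤ ρ ^ (α * ((n + 1 : ℕ) : ℝ)) * ((r (n + 1) : ℝ) ^ 2)⁻¹ *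
          (2 * (2 * (r (n + 1) : ℝ) ^ 2 * D * K ^ n)) :=
          mul_le_mul_of_nonneg_left hA (by positivity)
      _ = _ := by
          rw [Real.rpow_mul hρ0.le, Real.rpow_natCast, pow_succ, mul_pow]
          field_simp
          ring
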